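/- Conventions. $\mathbf{Top}$ is the category of all topological spaces and continuous maps, with its Cartesian monoidal structure. For a space $X$, let $VX$ be the set of continuous valuations on $X$, i.e. of maps $\nu$ from the open sets of $X$ to $[0,\infty]$ that are strict ($\nu(\emptyset)=0$), monotone, modular ($\nu(U\cup W)+\nu(U\cap W)=\nu(U)+\nu(W)$) and Scott continuous ($\nu(\bigcup_\lambda U_\lambda)=\sup_\lambda\nu(U_\lambda)$ for directed families), with the topology generated by the sets $\{\nu:\nu(U)>r\}$, $U\subseteq X$ open, $r\in[0,\infty)$. For lower semicontinuous $g:X\to[0,\infty]$, $\langle\nu,g\rangle$ is the supremum of $\sum_i r_i\nu(U_i)$ over all finite sums $\sum_i r_i 1_{U_i}\le g$ with $U_i$ open and $r_i\in[0,\infty]$. A Borel measure $m$ is $\tau$-smooth if $m(\bigcup_\lambda U_\lambda)=\sup_\lambda m(U_\lambda)$ for every directed family of open sets. $PX$ is the set of $\tau$-smooth Borel probability measures on $X$, with the subspace topology along the restriction map $\iota:PX\to VX$. $V$ and $P$ are endofunctors of $\mathbf{Top}$ via pushforward. For a strength $s$ on a monad $T$ with multiplication $\mu$, $t:TX\times Y\to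 T(X\times Y)$ is the costrength induced by symmetry and $\nabla:=\mu\circ T(t)\circ s:TX\times TY\to T(X\times Y)$; $T$ is commutative if $\nabla=\mu\circ T(s)\circ t$. Theorem. (1) $V$ carries a monad structure with unit $\delta$ and multiplication $\mathcal E$ given by $\langle\delta_x,g\rangle=g(x)$ and $\langle\mathcal E\xi,g\rangle=\langle\xi,\langle-,g\rangle\rangle$ for all lower semicontinuous $g:X\to[0,\infty]$, and a strength $s:X\times VY\to V(X\times Y)$ given by $s(x,\nu)(W)=\nu(W_x)$ for $W$ open, where $W_x=\{y:(x,y)\in W\}$. $P$ carries a monad structure with unit $\delta_x(A)=1_A(x)$ and multiplication $(\mathrm E\mu)(A)=\int_{PX}p(A)\,d\mu(p)$ for $A$ Borel, and $\iota:P\to V$ is a morphism of monads whose components are topological embeddings, so that $P$ is a submonad of $V$. The strength $s$ of $V$ restricts along $\iota$ to a strength of the monad $P$, given by maps $X\times PY\to P(X\times Y)$, $(x,p)\mapsto\delta_x\otimes p$, with $(\delta_x\otimes p)(A)=p(A_x)$ for every Borel set $A\subseteq X\times Y$. With these strengths both $V$ and $P$ are commutative monads. The maps $\nabla$ make $V$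 and $P$ into symmetric monoidal monads, and $\iota$ is a monoidal natural transformation, so that it is an inclusion of monoidal monads. For $p\in PX$, $q\in PY$ and Borel sets $A\subseteq X$, $B\subseteq Y$ one has $\nabla(p,q)(A\times B)=p(A)\,q(B)$. (2) For any topological spaces $X$ and $Y$ and any finite (for example, probability) $\tau$-smooth Borel measures $\mu$ on $X$ and $\nu$ on $Y$, the product measure $\mu\otimes\nu$, defined on the product of the two Borel $\sigma$-algebras, extends to a $\tau$-smooth Borel measure on the product space $X\times Y$. -/

import Mathlib

open CategoryTheory MonoidalCategory TopologicalSpace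
open scoped ENNReal NNReal MeasureTheory

universe u v

noncomputable section

namespace TauSmooth

/-! ## Continuous valuations -/

/-- A continuous valuation on `X`: a map from the open sets to `[0,∞]` which is strict, monotone,
modular and Scott continuous. -/
@[ext]
structure Valuation (X : Type u) [TopologicalSpace X] where
  toFun : Opens X → ℝ≥0∞
  strict : toFun ⊥ = 0
  mono : ∀ U V : Opens X, U ≤ V → toFun U ≤ toFun V
  modular : ∀ U V : Opens X, toFun (U ⊔ V) + toFun (U ⊓ V) = toFun U + toFun V
  scott : ∀ D : Set (Opens X), D.Nonempty → DirectedOn (· ≤ ·) D →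
    toFun (sSup D) = ⨆ U ∈ D, toFun U

/-- The space `VX` carries the topology generated by the sets `{ν | ν(U) > r}`, `U ⊆ X` open,
`r ∈ [0,∞)`. -/
instance (X : Type u) [TopologicalSpace X] : TopologicalSpace (Valuation X) :=
  generateFrom {S | ∃ (U : Opens X) (r : ℝ≥0), S = {ν : Valuation X | (r : ℝ≥0∞) < ν.toFun U}}

/-- The lower integral `⟨ν, g⟩ = ∫ g dν`: the supremum of `∑ i, r i * ν (U i)` over all simple
lower semicontinuous functions `∑ i, r i • 1_{U i} ≤ g`. -/
def Valuation.integral {X : Type u} [TopologicalSpace X] (ν : Valuation X) (g : X → ℝ≥0∞) :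
    ℝ≥0∞ :=
  ⨆ (n : ℕ) (r : Fin n → ℝ≥0∞) (U : Fin n → Opens X)
    (_ : ∀ x, ∑ i, (U i : Set X).indicator (fun _ => r i) x ≤ g x), ∑ i, r i * ν.toFun (U i)

/-- The pushforward of a continuous valuation, `(f_* ν)(U) = ν (f⁻¹ U)`. -/
def Valuation.map {X : Type u} {Y : Type v} [TopologicalSpace X] [TopologicalSpace Y]
    (f : C(X, Y)) (ν : Valuation X) : Valuation Y where
  toFun U := ν.toFun (Opens.comap f U)
  strict := by
    have h : Opens.comap f (⊥ : Opens Y) = ⊥ := by ext; simp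
    rw [h, ν.strict]
  mono U V h := ν.mono _ _ (OrderHomClass.mono (Opens.comap f) h)
  modular U V := by simpa using ν.modular (Opens.comap f U) (Opens.comap f V)
  scott D hne hD := by
    rw [map_sSup, ν.scott _ (hne.image _), iSup_image]
    rintro _ ⟨U, hU, rfl⟩ _ ⟨V, hV, rfl⟩
    obtain ⟨W, hW, h1, h2⟩ := hD U hU V hV
    exact ⟨_, ⟨W, hW, rfl⟩, OrderHomClass.mono (Opens.comap f) h1,
      OrderHomClass.mono (Opens.comap f) h2⟩

theorem Valuation.continuous_map {X : Type u} {Y : Type v} [TopologicalSpace X]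
    [TopologicalSpace Y] (f : C(X, Y)) : Continuous (Valuation.map f) := by
  refine continuous_generateFrom_iff.2 ?_
  rintro _ ⟨U, r, rfl⟩
  exact isOpen_generateFrom_of_mem ⟨Opens.comap f U, r, rfl⟩

/-- The functor `V` of continuous valuations on the category of topological spaces. -/
def V : TopCat.{u} ⥤ TopCat.{u} where
  obj X := TopCat.of (Valuation X)
  map f := TopCat.ofHom ⟨Valuation.map f.hom, Valuation.continuous_map f.hom⟩
  map_id _ := rfl
  map_comp _ _ := rfl

/-! ## τ-smooth Borel measures -/

/-- A Borel measure `m` on `X` is τ-smooth if `m (⋃ U_λ) = sup m (U_λ)` for every directed net of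
open sets. -/
def IsTauSmooth {X : Type u} [TopologicalSpace X] (m : @MeasureTheory.Measure X (borel X)) :
    Prop :=
  ∀ D : Set (Opens X), D.Nonempty → DirectedOn (· ≤ ·) D →
    m ((sSup D : Opens X) : Set X) = ⨆ U ∈ D, m (U : Set X)

/-- The set `PX` of τ-smooth Borel probability measures on `X`. -/
structure TauProb (X : Type u) [TopologicalSpace X] where
  measure : @MeasureTheory.Measure X (borel X)
  isProb : @MeasureTheory.IsProbabilityMeasure X (borel X) measure
  isTauSmooth : IsTauSmooth measure

/-- The restriction of a τ-smooth Borel probability measure to the open sets. -/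
def TauProb.toValuation {X : Type u} [TopologicalSpace X] (p : TauProb X) : Valuation X where
  toFun U := p.measure (U : Set X)
  strict := by simp
  mono U V h := MeasureTheory.measure_mono h
  modular U V := by
    let _ : MeasurableSpace X := borel X
    have _ : BorelSpace X := ⟨rfl⟩
    simpa using MeasureTheory.measure_union_add_inter (μ := p.measure) (U : Set X)
      V.isOpen.measurableSet
  scott := p.isTauSmooth

/-- The A-topology on `PX`: the subspace topology inherited from `VX`. -/
instance (X : Type u) [TopologicalSpace X] : TopologicalSpace (TauProb X) :=
  TopologicalSpace.induced TauProb.toValuation inferInstance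

theorem measurable_borel {X : Type u} {Y : Type v} [TopologicalSpace X] [TopologicalSpace Y]
    (f : C(X, Y)) : @Measurable X Y (borel X) (borel Y) f := by
  let _ : MeasurableSpace X := borel X
  have _ : BorelSpace X := ⟨rfl⟩
  let _ : MeasurableSpace Y := borel Y
  have _ : BorelSpace Y := ⟨rfl⟩
  exact f.continuous.measurable

/-- The pushforward of a Borel measure along a continuous map. -/
def pushforward {X : Type u} {Y : Type v} [TopologicalSpace X] [TopologicalSpace Y]
    (f : C(X, Y)) (m : @MeasureTheory.Measure X (borel X)) :
    @MeasureTheory.Measure Y (borel Y) :=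
  @MeasureTheory.Measure.map X Y (borel X) (borel Y) f m

theorem pushforward_apply {X : Type u} {Y : Type v} [TopologicalSpace X] [TopologicalSpace Y]
    (f : C(X, Y)) (m : @MeasureTheory.Measure X (borel X)) {B : Set Y}
    (hB : MeasurableSet[borel Y] B) : pushforward f m B = m (f ⁻¹' B) :=
  @MeasureTheory.Measure.map_apply X Y (borel X) (borel Y) m f (measurable_borel f) B hB

theorem measurableSet_opens {X : Type u} [TopologicalSpace X] (U : Opens X) :
    MeasurableSet[borel X] (U : Set X) :=
  MeasurableSpace.measurableSet_generateFrom U.isOpen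

/-- The pushforward map `PX → PY`. -/
def TauProb.map {X : Type u} {Y : Type v} [TopologicalSpace X] [TopologicalSpace Y]
    (f : C(X, Y)) (p : TauProb X) : TauProb Y where
  measure := pushforward f p.measure
  isProb := @MeasureTheory.IsProbabilityMeasure.mk Y (borel Y) _ (by
    rw [pushforward_apply f _ (@MeasurableSet.univ Y (borel Y)), Set.preimage_univ]
    exact p.isProb.measure_univ)
  isTauSmooth D hne hD := by
    have h : ∀ U : Opens Y, pushforward f p.measure (U : Set Y)
        = (Valuation.map f p.toValuation).toFun U := fun U =>
      pushforward_apply f _ (measurableSet_opens U)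
    simp only [h]
    exact (Valuation.map f p.toValuation).scott D hne hD

theorem TauProb.toValuation_map {X : Type u} {Y : Type v} [TopologicalSpace X]
    [TopologicalSpace Y] (f : C(X, Y)) (p : TauProb X) :
    (p.map f).toValuation = p.toValuation.map f := by
  ext U
  exact pushforward_apply f _ (measurableSet_opens U)

theorem TauProb.continuous_toValuation (X : Type u) [TopologicalSpace X] :
    Continuous (TauProb.toValuation (X := X)) :=
  continuous_induced_dom

theorem TauProb.continuous_map {X : Type u} {Y : Type v} [TopologicalSpace X]
    [TopologicalSpace Y] (f : C(X, Y)) : Continuous (TauProb.map f) := by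
  refine continuous_induced_rng.2 ?_
  have h : TauProb.toValuation ∘ TauProb.map f = Valuation.map f ∘ TauProb.toValuation :=
    funext fun p => TauProb.toValuation_map f p
  rw [h]
  exact (Valuation.continuous_map f).comp (TauProb.continuous_toValuation X)

theorem TauProb.ext_measure {X : Type u} [TopologicalSpace X] {p q : TauProb X}
    (h : p.measure = q.measure) : p = q := by
  cases p; cases q; cases h; rfl

/-- The functor `P` of τ-smooth Borel probability measures. -/
def P : TopCat.{u} ⥤ TopCat.{u} where
  obj X := TopCat.of (TauProb X)
  map f := TopCat.ofHom ⟨TauProb.map f.hom, TauProb.continuous_map f.hom⟩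
  map_id X := by
    ext p
    exact TauProb.ext_measure (@MeasureTheory.Measure.map_id X (borel X) p.measure)
  map_comp {X Y Z} f g := by
    ext p
    exact TauProb.ext_measure (@MeasureTheory.Measure.map_map X Y Z (borel X) (borel Y) (borel Z)
      p.measure g.hom f.hom (measurable_borel g.hom) (measurable_borel f.hom)).symm

/-- The inclusion `ι : P → V`. -/
def ι : P.{u} ⟶ V.{u} where
  app X := TopCat.ofHom ⟨TauProb.toValuation, TauProb.continuous_toValuation X⟩
  naturality _ _ f := by
    ext p : 2
    exact TauProb.toValuation_map f.hom p

/-! ## Strong, commutative and symmetric monoidal monads -/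

/-- A monad structure on a given endofunctor. -/
structure MonadStructure {C : Type u} [Category.{v} C] (T : C ⥤ C) where
  unit : 𝟭 C ⟶ T
  mul : T ⋙ T ⟶ T
  assoc : ∀ X, T.map (mul.app X) ≫ mul.app X = mul.app (T.obj X) ≫ mul.app X
  left_unit : ∀ X, unit.app (T.obj X) ≫ mul.app X = 𝟙 (T.obj X)
  right_unit : ∀ X, T.map (unit.app X) ≫ mul.app X = 𝟙 (T.obj X)

/-- The monad given by an endofunctor and a monad structure on it. -/
abbrev MonadStructure.monad {C : Type u} [Category.{v} C] {T : C ⥤ C} (M : MonadStructure T) :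
    Monad C where
  toFunctor := T
  η := M.unit
  μ := M.mul
  assoc := M.assoc
  left_unit := M.left_unit
  right_unit := M.right_unit

/-- A strength on a monad `T` on a monoidal category. -/
structure Strength {C : Type u} [Category.{v} C] [MonoidalCategory C] (T : Monad C) where
  s : ∀ X Y : C, X ⊗ T.obj Y ⟶ T.obj (X ⊗ Y)
  natural_left : ∀ {X Z : C} (f : X ⟶ Z) (Y : C),
    f ▷ T.obj Y ≫ s Z Y = s X Y ≫ T.map (f ▷ Y)
  natural_right : ∀ (X : C) {Y W : C} (g : Y ⟶ W),
    X ◁ T.map g ≫ s X W = s X Y ≫ T.map (X ◁ g)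
  unitor : ∀ X : C, s (𝟙_ C) X ≫ T.map (λ_ X).hom = (λ_ (T.obj X)).hom
  associator : ∀ X Y Z : C,
    s (X ⊗ Y) Z ≫ T.map (α_ X Y Z).hom = (α_ X Y (T.obj Z)).hom ≫ X ◁ s Y Z ≫ s X (Y ⊗ Z)
  unit : ∀ X Y : C, X ◁ T.η.app Y ≫ s X Y = T.η.app (X ⊗ Y)
  mul : ∀ X Y : C,
    s X (T.obj Y) ≫ T.map (s X Y) ≫ T.μ.app (X ⊗ Y) = X ◁ T.μ.app Y ≫ s X Y

namespace Strength

variable {C : Type u} [Category.{v} C] [MonoidalCategory C] [BraidedCategory C] {T : Monad C}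

/-- The costrength `TX ⊗ Y ⟶ T (X ⊗ Y)` induced by a strength. -/
def t (S : Strength T) (X Y : C) : T.obj X ⊗ Y ⟶ T.obj (X ⊗ Y) :=
  (β_ (T.obj X) Y).hom ≫ S.s Y X ≫ T.map (β_ Y X).hom

/-- The map `∇ : TX ⊗ TY ⟶ T (X ⊗ Y)` induced by a strength (strength first, then costrength). -/
def nabla (S : Strength T) (X Y : C) : T.obj X ⊗ T.obj Y ⟶ T.obj (X ⊗ Y) :=
  S.s (T.obj X) Y ≫ T.map (S.t X Y) ≫ T.μ.app (X ⊗ Y)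

/-- A strong monad is commutative if strength and costrength are compatible. -/
def IsCommutative (S : Strength T) : Prop :=
  ∀ X Y : C, S.nabla X Y = S.t X (T.obj Y) ≫ T.map (S.s X Y) ≫ T.μ.app (X ⊗ Y)

end Strength

/-- A symmetric monoidal monad structure on a monad `T`: a symmetric lax monoidal structure on the
functor `T` whose unit is the unit of the monad, such that unit and multiplication of the monad are
compatible with the tensorator. -/
structure SymmetricMonoidalMonad {C : Type u} [Category.{v} C] [MonoidalCategory C]
    [BraidedCategory C] (T : Monad C) where
  lax : T.toFunctor.LaxBraided
  ε_eq : lax.ε = T.η.app (𝟙_ C)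
  unit : ∀ X Y : C, (T.η.app X ⊗ₘ T.η.app Y) ≫ lax.μ X Y = T.η.app (X ⊗ Y)
  mul : ∀ X Y : C, lax.μ (T.obj X) (T.obj Y) ≫ T.map (lax.μ X Y) ≫ T.μ.app (X ⊗ Y)
    = (T.μ.app X ⊗ₘ T.μ.app Y) ≫ lax.μ X Y

/-- The pair `(x, y)` as a point of the product space. -/
def pair {X Y : TopCat.{u}} (x : X) (y : Y) : (X ⊗ Y : TopCat.{u}) := (x, y)

/-- The slice `A_x = {y | (x, y) ∈ A}`. -/
def slice {X Y : TopCat.{u}} (A : Set (X ⊗ Y : TopCat.{u})) (x : X) : Set Y :=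
  {y | pair x y ∈ A}

theorem isOpen_slice {X Y : TopCat.{u}} (W : Opens (X ⊗ Y : TopCat.{u})) (x : X) :
    IsOpen (slice (W : Set (X ⊗ Y : TopCat.{u})) x) :=
  W.isOpen.preimage (f := fun y : Y => pair x y)
    (Continuous.prodMk_right x : Continuous fun y : Y => (x, y))

/-- The slice of an open set, as an open set. -/
def openSlice {X Y : TopCat.{u}} (W : Opens (X ⊗ Y : TopCat.{u})) (x : X) : Opens Y :=
  ⟨slice (W : Set (X ⊗ Y : TopCat.{u})) x, isOpen_slice W x⟩

/-- The rectangle `A × B` as a subset of the product space. -/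
def rect {X Y : TopCat.{u}} (A : Set X) (B : Set Y) : Set (X ⊗ Y : TopCat.{u}) :=
  A ×ˢ B

end TauSmooth

end

/-! The integral `⟨ν, g⟩` is a supremum over simple functions, from which additivity is hard to see.
For lower semicontinuous `g` it equals the layer cake integral `∫₀^∞ ν {g > t} dt`
(`Valuation.integral_eq_lcint`). Scott continuity of `ν` makes `t ↦ ν {g > t}` right continuous, so
this integral is a supremum of dyadic sums. Such sums commute with directed suprema of any
cardinality (`Valuation.lcint_iSup`), while modularity computes the effect of adding `r • 1_U`
(`Valuation.lcint_add_indicator`). Every lower semicontinuous `g` is an iterated increasing supremum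
of step functions, so an induction principle yields linearity and the formula for integrals against
`join`, and with these the monad laws of `V`.

The strength is pushforward along `y ↦ (x, y)`, and the point is its joint continuity
(`lowerSemicontinuous_strength`). Open rectangles form a basis closed under intersection, and a
valuation is determined by its values on such a basis (`Valuation.ext_of_isBasis`). Both orders of
integration give `ν(U) ρ(V)` on `U × V`. This proves commutativity, and the same test on rectangles
gives the remaining coherence laws of products.

For `P`, a finite Borel measure is determined by its values on open sets, so the components of `ι`
are monomorphisms. Once unit, multiplication and strength have been lifted along `ι`, every law of
`P` follows from that of `V` by cancelling `ι`. The multiplication lifts because a mixture of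
τ-smooth measures is τ-smooth (`isTauSmooth_mixture`): the integral of a lower semicontinuous
function against a τ-smooth measure is a layer cake integral of its valuation. Part (2) is the
mixture over `μ` of the measures `δ_x ⊗ ν`. -/

noncomputable section

namespace TauSmooth

open MeasureTheory Set

section Functions

variable {X : Type u} {Y : Type v} [TopologicalSpace X] [TopologicalSpace Y]

/-! ## Dyadic sums of antitone functions -/

/-- The `n`-th lower dyadic Riemann sum of `φ` on `(0, ∞)`. -/
def dyadicSum (φ : ℝ → ℝ≥0∞) (n : ℕ) : ℝ≥0∞ :=
  ∑' k : ℕ, ENNReal.ofReal ((2 ^ n : ℝ)⁻¹) * φ ((k + 1) / 2 ^ n)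

/-- The least multiple of `2⁻ⁿ` which is larger than `t`. -/
def nextDyadic (n : ℕ) (t : ℝ) : ℝ := (⌊2 ^ n * t⌋₊ + 1) / 2 ^ n

theorem lt_nextDyadic (n : ℕ) (t : ℝ) : t < nextDyadic n t := by
  rw [nextDyadic, lt_div_iff₀ (by positivity), mul_comm]
  exact Nat.lt_floor_add_one _

theorem nextDyadic_le (n : ℕ) {t : ℝ} (ht : 0 ≤ t) : nextDyadic n t ≤ t + (2 ^ n)⁻¹ := by
  rw [nextDyadic, div_le_iff₀ (by positivity), add_mul, inv_mul_cancel₀ (by positivity)]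
  have := Nat.floor_le (show (0 : ℝ) ≤ 2 ^ n * t by positivity)
  linarith

/-- Multiples of `2⁻ⁿ` are also multiples of `2⁻⁽ⁿ⁺¹⁾`, so refining the grid can only bring the next
point closer. -/
theorem nextDyadic_succ_le (n : ℕ) (t : ℝ) : nextDyadic (n + 1) t ≤ nextDyadic n t := by
  rw [nextDyadic, nextDyadic, div_le_div_iff₀ (by positivity) (by positivity)]
  have h : ⌊(2 : ℝ) ^ (n + 1) * t⌋₊ + 1 ≤ 2 * (⌊(2 : ℝ) ^ n * t⌋₊ + 1) := by
    rw [Nat.succ_le_iff, Nat.floor_lt' (by positivity)]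
    have := Nat.lt_floor_add_one ((2 : ℝ) ^ n * t)
    push_cast
    rw [pow_succ]
    linarith
  have h' : ((⌊(2 : ℝ) ^ (n + 1) * t⌋₊ : ℝ) + 1) ≤ 2 * (⌊(2 : ℝ) ^ n * t⌋₊ + 1) := by
    exact_mod_cast h
  calc ((⌊(2 : ℝ) ^ (n + 1) * t⌋₊ : ℝ) + 1) * 2 ^ n
      ≤ 2 * (⌊(2 : ℝ) ^ n * t⌋₊ + 1) * 2 ^ n := by gcongr
    _ = (⌊(2 : ℝ) ^ n * t⌋₊ + 1) * 2 ^ (n + 1) := by ring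

theorem monotone_nextDyadic (n : ℕ) : Monotone (nextDyadic n) := fun s t h => by
  unfold nextDyadic
  gcongr

/-- The integrand is constant on each interval `[k/2ⁿ, (k+1)/2ⁿ)`, and these tile the closed half
line, which differs from the open one by a null set. -/
theorem lintegral_nextDyadic (φ : ℝ → ℝ≥0∞) (n : ℕ) :
    ∫⁻ t in Ioi (0 : ℝ), φ (nextDyadic n t) = dyadicSum φ n := by
  have hU : Ici (0 : ℝ) = ⋃ k : ℕ, Ico ((k : ℝ) / 2 ^ n) ((k + 1) / 2 ^ n) := by
    ext t
    simp only [mem_Ici, mem_iUnion, mem_Ico]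
    constructor
    · intro ht
      refine ⟨⌊2 ^ n * t⌋₊, ?_, lt_nextDyadic n t⟩
      rw [div_le_iff₀ (by positivity), mul_comm]
      exact Nat.floor_le (by positivity)
    · rintro ⟨k, hk, -⟩
      exact le_trans (by positivity) hk
  have hfl : ∀ (k : ℕ) (t : ℝ), t ∈ Ico ((k : ℝ) / 2 ^ n) ((k + 1) / 2 ^ n) →
      ⌊2 ^ n * t⌋₊ = k := by
    intro k t ht
    have h1 := (div_le_iff₀ (by positivity)).1 ht.1
    have h2 := (lt_div_iff₀ (by positivity)).1 ht.2
    rw [Nat.floor_eq_iff (le_trans (by positivity) (h1.trans_eq (mul_comm _ _)))]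
    constructor <;> linarith
  rw [setLIntegral_congr Ioi_ae_eq_Ici, hU, lintegral_iUnion (fun _ => measurableSet_Ico)]
  · refine tsum_congr fun k => ?_
    rw [setLIntegral_congr_fun (g := fun _ => φ ((k + 1) / 2 ^ n)) measurableSet_Ico,
      setLIntegral_const, Real.volume_Ico, mul_comm]
    · congr 2
      field_simp
      ring
    · intro t ht
      simp only [nextDyadic, hfl k t ht]
  · intro i j hij
    refine Set.disjoint_left.2 fun t hi hj => hij ?_
    rw [← hfl i t hi, hfl j t hj]

theorem monotone_dyadicSum {φ : ℝ → ℝ≥0∞} (hφ : Antitone φ) : Monotone (dyadicSum φ) := by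
  refine monotone_nat_of_le_succ fun n => ?_
  rw [← lintegral_nextDyadic, ← lintegral_nextDyadic]
  exact lintegral_mono fun t => hφ (nextDyadic_succ_le n t)

/-- Since `nextDyadic n t` decreases to `t` from the right, the right continuity `hc` identifies the
pointwise supremum, and monotone convergence applies. -/
theorem lintegral_eq_iSup_dyadicSum {φ : ℝ → ℝ≥0∞} (hφ : Antitone φ)
    (hc : ∀ t, 0 ≤ t → φ t ≤ ⨆ s : Ioi t, φ s) :
    ∫⁻ t in Ioi (0 : ℝ), φ t = ⨆ n, dyadicSum φ n := by
  simp only [← lintegral_nextDyadic]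
  rw [← lintegral_iSup (f := fun n t => φ (nextDyadic n t))
    (fun n => (hφ.comp_monotone (monotone_nextDyadic n)).measurable)
    (monotone_nat_of_le_succ fun n t => hφ (nextDyadic_succ_le n t))]
  refine setLIntegral_congr_fun measurableSet_Ioi fun t ht => le_antisymm ?_ ?_
  · refine (hc t (le_of_lt ht)).trans (iSup_le ?_)
    rintro ⟨s, hs⟩
    obtain ⟨n, hn⟩ := exists_pow_lt_of_lt_one (sub_pos.2 hs) (show (2⁻¹ : ℝ) < 1 by norm_num)
    refine le_iSup_of_le n (hφ ((nextDyadic_le n (le_of_lt ht)).trans ?_))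
    rw [inv_pow] at hn
    linarith
  · exact iSup_le fun n => hφ (lt_nextDyadic n t).le

/-! ## The layer cake integral of a valuation -/

theorem Valuation.toFun_iSup {ι : Type*} [Nonempty ι] (ν : Valuation X) (U : ι → Opens X)
    (hU : Directed (· ≤ ·) U) : ν.toFun (⨆ i, U i) = ⨆ i, ν.toFun (U i) := by
  rw [← sSup_range, ν.scott _ (range_nonempty U) hU.directedOn_range, iSup_range]

/-- The open set on which `g` exceeds `a`. -/
def superlevel (g : X → ℝ≥0∞) (a : ℝ≥0∞) : Opens X :=
  ⟨interior {x | a < g x}, isOpen_interior⟩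

/-- The interior only serves to make `superlevel` total; it changes nothing when `g` is lower
semicontinuous. -/
theorem mem_superlevel {g : X → ℝ≥0∞} (hg : LowerSemicontinuous g) {a : ℝ≥0∞} {x : X} :
    x ∈ superlevel g a ↔ a < g x := by
  change x ∈ interior {x | a < g x} ↔ _
  rw [IsOpen.interior_eq (s := {x | a < g x}) (hg.isOpen_preimage a), Set.mem_ofPred_eq]

theorem superlevel_mono {f g : X → ℝ≥0∞} (h : f ≤ g) {a b : ℝ≥0∞} (hab : b ≤ a) :
    superlevel f a ≤ superlevel g b :=
  interior_mono fun x hx => (hab.trans_lt hx).trans_le (h x)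

/-- The layer cake integral `∫₀^∞ ν {g > t} dt`. -/
def Valuation.lcint (ν : Valuation X) (g : X → ℝ≥0∞) : ℝ≥0∞ :=
  ∫⁻ t in Ioi (0 : ℝ), ν.toFun (superlevel g (ENNReal.ofReal t))

theorem Valuation.lcint_mono (ν : Valuation X) {f g : X → ℝ≥0∞} (h : f ≤ g) :
    ν.lcint f ≤ ν.lcint g :=
  lintegral_mono fun _ => ν.mono _ _ (superlevel_mono h le_rfl)

theorem antitone_toFun_superlevel (ν : Valuation X) (g : X → ℝ≥0∞) :
    Antitone fun t : ℝ => ν.toFun (superlevel g (ENNReal.ofReal t)) := fun _ _ h =>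
  ν.mono _ _ (superlevel_mono le_rfl (ENNReal.ofReal_le_ofReal h))

/-- `{g > t}` is the directed union of the sets `{g > s}` with `s > t`, so Scott continuity supplies
the required right continuity. -/
theorem Valuation.lcint_eq_iSup_dyadicSum (ν : Valuation X) {g : X → ℝ≥0∞}
    (hg : LowerSemicontinuous g) :
    ν.lcint g = ⨆ n, dyadicSum (fun t => ν.toFun (superlevel g (ENNReal.ofReal t))) n := by
  refine lintegral_eq_iSup_dyadicSum (antitone_toFun_superlevel ν g) fun t ht => ?_
  rw [← ν.toFun_iSup (fun s : Ioi t => superlevel g (ENNReal.ofReal s))]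
  · refine ν.mono _ _ fun x hx => ?_
    obtain ⟨s, hs, hs'⟩ := ENNReal.lt_iff_exists_nnreal_btwn.1 ((mem_superlevel hg).1 hx)
    refine Opens.mem_iSup.2 ⟨⟨s, ?_⟩, (mem_superlevel hg).2 ?_⟩
    · rw [mem_Ioi]
      rwa [← ENNReal.ofReal_coe_nnreal, ENNReal.ofReal_lt_ofReal_iff_of_nonneg ht] at hs
    · simpa using hs'
  · exact Antitone.directed_le fun a b h =>
      superlevel_mono le_rfl (ENNReal.ofReal_le_ofReal h)

theorem lowerSemicontinuous_indicator (U : Opens X) (r : ℝ≥0∞) :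
    LowerSemicontinuous ((U : Set X).indicator fun _ => r) :=
  U.isOpen.lowerSemicontinuous_indicator zero_le

theorem Valuation.lcint_zero (ν : Valuation X) : ν.lcint 0 = 0 := by
  have h : ∀ a, superlevel (0 : X → ℝ≥0∞) a = ⊥ := fun a => by
    ext x
    exact (mem_superlevel lowerSemicontinuous_const).trans (by simp)
  simp [lcint, h, ν.strict]

theorem setLIntegral_Ioi_sub (φ : ℝ → ℝ≥0∞) (r : ℝ) :
    ∫⁻ t in Ioi r, φ (t - r) = ∫⁻ t in Ioi 0, φ t := by
  rw [← lintegral_indicator measurableSet_Ioi, ← lintegral_indicator measurableSet_Ioi,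
    ← lintegral_sub_right_eq_self ((Ioi 0).indicator φ) r]
  refine lintegral_congr fun t => ?_
  simp [indicator_apply]

/-- Let `B t = ν({f > t} ∩ U)`. For `t < r` one has `{g > t} = {f > t} ∪ U`, and for `t > r` one has
`{g > t} = {f > t} ∪ ({f > t - r} ∩ U)`. Modularity turns these into `ν{g > t} + B t = ν{f > t} +
ν(U)` and `ν{g > t} + B t = ν{f > t} + B (t - r)`. Integrating produces `∫ B` on both sides, to be
cancelled. -/
theorem Valuation.lcint_add_indicator (ν : Valuation X) {f : X → ℝ≥0∞}
    (hf : LowerSemicontinuous f) (U : Opens X) (r : ℝ≥0∞) :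
    ν.lcint (f + (U : Set X).indicator fun _ => r) = ν.lcint f + r * ν.toFun U := by
  set g := f + (U : Set X).indicator fun _ => r with hgdef
  have hg : LowerSemicontinuous g := hf.add (lowerSemicontinuous_indicator U r)
  have hfg : f ≤ g := fun x => le_self_add
  have hgU : ∀ x ∈ U, g x = f x + r := fun x hx => by
    simp [hgdef, indicator_of_mem (show x ∈ (U : Set X) from hx)]
  have hgU' : ∀ x ∉ U, g x = f x := fun x hx => by
    simp [hgdef, indicator_of_notMem (show x ∉ (U : Set X) from hx)]
  set B : ℝ → ℝ≥0∞ := fun t => ν.toFun (superlevel f (ENNReal.ofReal t) ⊓ U) with hB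
  have hBm : Antitone B := fun s t h => ν.mono _ _ <|
    inf_le_inf_right _ (superlevel_mono le_rfl (ENNReal.ofReal_le_ofReal h))
  have hBf : ∫⁻ t in Ioi 0, B t ≤ ν.lcint f := lintegral_mono fun t => ν.mono _ _ inf_le_left
  have hlow : ∀ t, ENNReal.ofReal t < r →
      superlevel g (ENNReal.ofReal t) = superlevel f (ENNReal.ofReal t) ⊔ U := by
    intro t ht
    ext x
    change x ∈ superlevel g _ ↔ x ∈ superlevel f _ ∨ x ∈ U
    rw [mem_superlevel hg, mem_superlevel hf]
    by_cases hx : x ∈ U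
    · simp only [hgU x hx, hx, or_true, iff_true]
      exact ht.trans_le le_add_self
    · simp [hgU' x hx, hx]
  -- For `r = ∞` only the first range of `t` occurs. If `ν(U) = 0`, then `B` vanishes; otherwise the
  -- left side is already infinite.
  rcases eq_or_ne r ∞ with rfl | hr
  · have key : ν.lcint g + ∫⁻ t in Ioi 0, B t = ν.lcint f + ∞ * ν.toFun U := by
      have h1 : ∫⁻ _ in Ioi (0 : ℝ), ν.toFun U = ∞ * ν.toFun U := by
        rw [setLIntegral_const, Real.volume_Ioi, mul_comm]
      rw [← h1, lcint, lcint, ← lintegral_add_left (antitone_toFun_superlevel ν g).measurable,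
        ← lintegral_add_left (antitone_toFun_superlevel ν f).measurable]
      refine lintegral_congr fun t => ?_
      rw [hlow t ENNReal.ofReal_lt_top]
      exact ν.modular _ _
    rcases eq_or_ne (ν.toFun U) 0 with h0 | h0
    · have hB0 : ∀ t, B t = 0 := fun t =>
        le_antisymm ((ν.mono _ _ inf_le_right).trans h0.le) zero_le
      simpa [hB0] using key
    · rw [ENNReal.top_mul h0, add_top]
      refine top_le_iff.1 ?_
      calc ∞ = ∫⁻ _ in Ioi (0 : ℝ), ν.toFun U := by
            rw [setLIntegral_const, Real.volume_Ioi, ENNReal.mul_top h0]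
        _ ≤ ν.lcint g := lintegral_mono fun t => by
            rw [hlow t ENNReal.ofReal_lt_top]
            exact ν.mono _ _ le_sup_right
  · lift r to ℝ≥0 using hr
    have hhigh : ∀ t, (r : ℝ) < t → superlevel g (ENNReal.ofReal t) =
        superlevel f (ENNReal.ofReal t) ⊔ (superlevel f (ENNReal.ofReal (t - r)) ⊓ U) := by
      intro t ht
      ext x
      change x ∈ superlevel g _ ↔ x ∈ superlevel f _ ∨ (x ∈ superlevel f _ ∧ x ∈ U)
      rw [mem_superlevel hg, mem_superlevel hf, mem_superlevel hf]
      by_cases hx : x ∈ U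
      · have h2 : ENNReal.ofReal t = ENNReal.ofReal (t - r) + r := by
          rw [← ENNReal.ofReal_coe_nnreal (p := r), ← ENNReal.ofReal_add (sub_pos.2 ht).le r.coe_nonneg,
            sub_add_cancel]
        have h3 : ENNReal.ofReal (t - r) ≤ ENNReal.ofReal t := h2 ▸ le_self_add
        rw [hgU x hx, h2, ENNReal.add_lt_add_iff_right ENNReal.coe_ne_top, ← h2]
        exact ⟨fun h => Or.inr ⟨h, hx⟩, fun h => h.elim (h3.trans_lt) (·.1)⟩
      · simp [hgU' x hx, hx]
    have hsplit : ∀ φ : ℝ → ℝ≥0∞, ∫⁻ t in Ioi 0, φ t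
        = (∫⁻ t in Ioo 0 (r : ℝ), φ t) + ∫⁻ t in Ioi (r : ℝ), φ t := by
      intro φ
      rw [← Ioc_union_Ioi_eq_Ioi r.coe_nonneg, lintegral_union measurableSet_Ioi
        (Set.disjoint_left.2 fun t h h' => not_lt.2 h.2 h'), ← setLIntegral_congr Ioo_ae_eq_Ioc]
    have key : ν.lcint g + ∫⁻ t in Ioi 0, B t
        = ν.lcint f + r * ν.toFun U + ∫⁻ t in Ioi 0, B t := by
      have e1 : (∫⁻ t in Ioo 0 (r : ℝ), ν.toFun (superlevel g (ENNReal.ofReal t)))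
          + ∫⁻ t in Ioo 0 (r : ℝ), B t
          = (∫⁻ t in Ioo 0 (r : ℝ), ν.toFun (superlevel f (ENNReal.ofReal t)))
            + r * ν.toFun U := by
        have h1 : ∫⁻ _ in Ioo 0 (r : ℝ), ν.toFun U = r * ν.toFun U := by
          rw [setLIntegral_const, Real.volume_Ioo, mul_comm]
          simp
        rw [← h1, ← lintegral_add_left (antitone_toFun_superlevel ν g).measurable,
          ← lintegral_add_left (antitone_toFun_superlevel ν f).measurable]
        refine setLIntegral_congr_fun measurableSet_Ioo fun t ht => ?_
        have ht' : ENNReal.ofReal t < r := by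
          rw [← ENNReal.ofReal_coe_nnreal]
          exact (ENNReal.ofReal_lt_ofReal_iff_of_nonneg ht.1.le).2 ht.2
        rw [hlow t ht']
        exact ν.modular _ _
      have e2 : (∫⁻ t in Ioi (r : ℝ), ν.toFun (superlevel g (ENNReal.ofReal t)))
          + ∫⁻ t in Ioi (r : ℝ), B t
          = (∫⁻ t in Ioi (r : ℝ), ν.toFun (superlevel f (ENNReal.ofReal t)))
            + ∫⁻ t in Ioi 0, B t := by
        rw [← setLIntegral_Ioi_sub B r,
          ← lintegral_add_left (antitone_toFun_superlevel ν g).measurable,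
          ← lintegral_add_left (antitone_toFun_superlevel ν f).measurable]
        refine setLIntegral_congr_fun measurableSet_Ioi fun t ht => ?_
        have h := ν.modular (superlevel f (ENNReal.ofReal t))
          (superlevel f (ENNReal.ofReal (t - r)) ⊓ U)
        rwa [← inf_assoc, inf_eq_left.2 (superlevel_mono (le_refl f) (ENNReal.ofReal_le_ofReal
          (sub_le_self t r.coe_nonneg))), ← hhigh t ht] at h
      rw [lcint, lcint, hsplit, hsplit B,
        hsplit fun t => ν.toFun (superlevel f (ENNReal.ofReal t)), add_add_add_comm, e1, e2,
        hsplit B]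
      abel
    -- Cancellation needs `∫ B < ∞`; if it is infinite, `∫ B ≤ ν.lcint f ≤ ν.lcint g` makes both
    -- sides infinite.
    rcases eq_or_ne (∫⁻ t in Ioi 0, B t) ∞ with hT | hT
    · have h1 : ν.lcint f = ∞ := top_le_iff.1 (hT ▸ hBf)
      have h2 : ν.lcint g = ∞ := top_le_iff.1 (h1 ▸ ν.lcint_mono hfg)
      rw [h1, h2, top_add]
    · exact (ENNReal.add_left_inj hT).1 key

/-! ## Scott continuity and linearity of the integral -/

/-- A dyadic sum is a supremum of finite sums, which commute with directed suprema. This covers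
uncountable families, where monotone convergence does not apply. -/
theorem dyadicSum_iSup {ι : Type*} [Nonempty ι] (φ : ι → ℝ → ℝ≥0∞) (hφ : Directed (· ≤ ·) φ)
    (n : ℕ) : dyadicSum (⨆ i, φ i) n = ⨆ i, dyadicSum (φ i) n := by
  simp only [dyadicSum, ENNReal.tsum_eq_iSup_sum, iSup_apply, ENNReal.mul_iSup]
  rw [iSup_comm]
  refine iSup_congr fun s => ENNReal.finsetSum_iSup fun i j => ?_
  obtain ⟨k, h1, h2⟩ := hφ i j
  exact ⟨k, fun a => ⟨mul_le_mul_right (h1 _) _, mul_le_mul_right (h2 _) _⟩⟩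

theorem lowerSemicontinuous_iSup_fun {ι : Type*} {g : ι → X → ℝ≥0∞}
    (hg : ∀ i, LowerSemicontinuous (g i)) : LowerSemicontinuous (⨆ i, g i) := by
  rw [show (⨆ i, g i) = fun x => ⨆ i, g i x from funext fun x => iSup_apply]
  exact lowerSemicontinuous_iSup hg

theorem lowerSemicontinuous_add {f g : X → ℝ≥0∞} (hf : LowerSemicontinuous f)
    (hg : LowerSemicontinuous g) : LowerSemicontinuous (f + g) :=
  hf.add hg

theorem superlevel_iSup {ι : Type*} (g : ι → X → ℝ≥0∞) (hg : ∀ i, LowerSemicontinuous (g i))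
    (a : ℝ≥0∞) : superlevel (⨆ i, g i) a = ⨆ i, superlevel (g i) a := by
  ext x
  change x ∈ superlevel _ a ↔ x ∈ ⨆ i, superlevel (g i) a
  rw [Opens.mem_iSup, mem_superlevel (lowerSemicontinuous_iSup_fun hg)]
  simp [mem_superlevel (hg _), lt_iSup_iff]

theorem Valuation.lcint_iSup {ι : Type*} [Nonempty ι] (ν : Valuation X) (g : ι → X → ℝ≥0∞)
    (hg : ∀ i, LowerSemicontinuous (g i)) (hd : Directed (· ≤ ·) g) :
    ν.lcint (⨆ i, g i) = ⨆ i, ν.lcint (g i) := by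
  have hφ : (fun t => ν.toFun (superlevel (⨆ i, g i) (ENNReal.ofReal t)))
      = ⨆ i, fun t => ν.toFun (superlevel (g i) (ENNReal.ofReal t)) := by
    funext t
    rw [iSup_apply, superlevel_iSup g hg]
    exact ν.toFun_iSup _ (hd.mono_comp (g := fun f => superlevel f (ENNReal.ofReal t)) _
      fun f f' h => superlevel_mono h le_rfl)
  rw [ν.lcint_eq_iSup_dyadicSum (lowerSemicontinuous_iSup_fun hg), hφ]
  simp_rw [ν.lcint_eq_iSup_dyadicSum (hg _)]
  rw [iSup_comm]
  exact iSup_congr fun n => dyadicSum_iSup _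
    (hd.mono_comp (g := fun f t => ν.toFun (superlevel f (ENNReal.ofReal t))) _
      fun f f' h t => ν.mono _ _ (superlevel_mono h le_rfl)) n

/-! ### Point valuations, dyadic approximation and linearity -/

/-- The point valuation at `x`. -/
def Valuation.dirac (x : X) : Valuation X where
  toFun U := (U : Set X).indicator 1 x
  strict := by simp
  mono U V h := indicator_le_indicator_of_subset h (fun _ => zero_le) x
  modular U V := indicator_union_add_inter_apply 1 (U : Set X) (V : Set X) x
  scott D hne hD := by
    by_cases h : ∃ U ∈ D, x ∈ U
    · obtain ⟨U, hU, hx⟩ := h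
      refine le_antisymm ?_ (iSup₂_le fun V hV =>
        indicator_le_indicator_of_subset (show V ≤ sSup D from le_sSup hV)
          (fun _ => zero_le) x)
      refine le_iSup₂_of_le U hU ?_
      rw [indicator_of_mem (show x ∈ (U : Set X) from hx)]
      exact indicator_apply_le' (fun _ => le_rfl) fun _ => zero_le
    · have h' : ∀ U ∈ D, x ∉ (U : Set X) := fun U hU hx => h ⟨U, hU, hx⟩
      rw [indicator_of_notMem fun hx => h (Opens.mem_sSup.1 hx)]
      symm
      simp only [ENNReal.iSup_eq_zero]
      exact fun U hU => indicator_of_notMem (h' U hU) _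

theorem Valuation.lcint_dirac (x : X) {g : X → ℝ≥0∞} (hg : LowerSemicontinuous g) :
    (Valuation.dirac x).lcint g = g x := by
  have h : ∀ t : ℝ, (Valuation.dirac x).toFun (superlevel g (ENNReal.ofReal t))
      = {t : ℝ | ENNReal.ofReal t < g x}.indicator 1 t := fun t => by
    change ((superlevel g (ENNReal.ofReal t) : Opens X) : Set X).indicator 1 x = _
    by_cases hx : ENNReal.ofReal t < g x
    · rw [indicator_of_mem (show t ∈ {t : ℝ | ENNReal.ofReal t < g x} from hx),
        indicator_of_mem (show x ∈ (superlevel g _ : Set X) from (mem_superlevel hg).2 hx)]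
      rfl
    · rw [indicator_of_notMem (show t ∉ {t : ℝ | ENNReal.ofReal t < g x} from hx),
        indicator_of_notMem fun h => hx ((mem_superlevel hg).1 h)]
  have hm : MeasurableSet {t : ℝ | ENNReal.ofReal t < g x} :=
    measurableSet_lt ENNReal.measurable_ofReal measurable_const
  simp only [lcint, h]
  rw [lintegral_indicator_one hm, Measure.restrict_apply hm]
  rcases eq_or_ne (g x) ∞ with hx | hx
  · simp [hx]
  · have : {t : ℝ | ENNReal.ofReal t < g x} ∩ Ioi 0 = Ioo 0 (g x).toReal := by
      ext t
      simp only [mem_inter_iff, mem_Ioi, mem_Ioo, Set.mem_ofPred_eq]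
      exact ⟨fun h => ⟨h.2, (ENNReal.ofReal_lt_iff_lt_toReal h.2.le hx).1 h.1⟩,
        fun h => ⟨(ENNReal.ofReal_lt_iff_lt_toReal h.1.le hx).2 h.2, h.1⟩⟩
    rw [this, Real.volume_Ioo, sub_zero, ENNReal.ofReal_toReal hx]

/-- The partial sums of the dyadic approximations of `g`. -/
def dyadicApprox (g : X → ℝ≥0∞) (n N : ℕ) : X → ℝ≥0∞ :=
  ∑ k ∈ Finset.range N, (superlevel g (ENNReal.ofReal ((k + 1) / 2 ^ n)) : Set X).indicator
    fun _ => ENNReal.ofReal ((2 ^ n : ℝ)⁻¹)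

theorem iSup_dyadicApprox_apply (g : X → ℝ≥0∞) (n : ℕ) (x : X) :
    (⨆ N, dyadicApprox g n N) x
      = dyadicSum (fun t => (Valuation.dirac x).toFun (superlevel g (ENNReal.ofReal t))) n := by
  rw [dyadicSum, ENNReal.tsum_eq_iSup_nat, iSup_apply]
  refine iSup_congr fun N => ?_
  rw [dyadicApprox, Finset.sum_apply]
  refine Finset.sum_congr rfl fun k _ => ?_
  by_cases hx : x ∈ (superlevel g (ENNReal.ofReal ((k + 1) / 2 ^ n)) : Set X) <;>
    simp [Valuation.dirac, hx]

/-- At `x` this is the dyadic formula for the integral of `g` against the point valuation at `x`. -/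
theorem iSup_dyadicApprox {g : X → ℝ≥0∞} (hg : LowerSemicontinuous g) :
    ⨆ n, ⨆ N, dyadicApprox g n N = g := by
  funext x
  rw [iSup_apply]
  simp only [iSup_dyadicApprox_apply]
  rw [← Valuation.lcint_eq_iSup_dyadicSum _ hg, Valuation.lcint_dirac x hg]

/-- To prove a property of all lower semicontinuous functions with values in `[0, ∞]` it suffices
to prove it for step functions and to show that it is stable under monotone suprema. -/
theorem lowerSemicontinuous_induction {Q : (X → ℝ≥0∞) → Prop} (zero : Q 0)
    (add : ∀ f, LowerSemicontinuous f → Q f → ∀ (U : Opens X) (r : ℝ≥0∞), r ≠ ∞ →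
      Q (f + (U : Set X).indicator fun _ => r))
    (iSup : ∀ g : ℕ → X → ℝ≥0∞, Monotone g → (∀ n, LowerSemicontinuous (g n)) →
      (∀ n, Q (g n)) → Q (⨆ n, g n)) {g : X → ℝ≥0∞} (hg : LowerSemicontinuous g) : Q g := by
  have h : ∀ n N, LowerSemicontinuous (dyadicApprox g n N) ∧ Q (dyadicApprox g n N) := by
    intro n N
    induction N with
    | zero =>
      simp only [dyadicApprox, Finset.range_zero, Finset.sum_empty]
      exact ⟨lowerSemicontinuous_const, zero⟩
    | succ N ih =>
      have e : dyadicApprox g n (N + 1) = dyadicApprox g n N + _ := Finset.sum_range_succ _ _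
      rw [e]
      exact ⟨ih.1.add (lowerSemicontinuous_indicator _ _),
        add _ ih.1 ih.2 _ _ ENNReal.ofReal_ne_top⟩
  rw [← iSup_dyadicApprox hg]
  refine iSup _ ?_ (fun n => lowerSemicontinuous_iSup_fun fun N => (h n N).1) fun n =>
    iSup _ ?_ (fun N => (h n N).1) fun N => (h n N).2
  · intro m n hmn x
    simp only [iSup_dyadicApprox_apply]
    exact monotone_dyadicSum (antitone_toFun_superlevel _ g) hmn
  · intro M N hMN
    exact Finset.sum_le_sum_of_subset (Finset.range_mono hMN)

theorem Valuation.lcint_add (ν : Valuation X) {f g : X → ℝ≥0∞} (hf : LowerSemicontinuous f)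
    (hg : LowerSemicontinuous g) : ν.lcint (f + g) = ν.lcint f + ν.lcint g := by
  refine lowerSemicontinuous_induction (Q := fun g => ν.lcint (f + g) = ν.lcint f + ν.lcint g)
    ?_ ?_ ?_ hg
  · simp [ν.lcint_zero]
  · intro g hg ih U r _
    rw [← add_assoc, ν.lcint_add_indicator (lowerSemicontinuous_add hf hg), ν.lcint_add_indicator hg, ih, add_assoc]
  · intro g hm hg ih
    have e : f + ⨆ n, g n = ⨆ n, (f + g n) := by
      funext x
      simp [ENNReal.add_iSup]
    rw [e, ν.lcint_iSup _ (fun n => lowerSemicontinuous_add hf (hg n))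
      (Monotone.directed_le fun m n h => add_le_add le_rfl (hm h)),
      ν.lcint_iSup g hg hm.directed_le, ENNReal.add_iSup]
    exact iSup_congr ih

theorem Valuation.lcint_indicator (ν : Valuation X) (U : Opens X) (r : ℝ≥0∞) :
    ν.lcint ((U : Set X).indicator fun _ => r) = r * ν.toFun U := by
  have h := ν.lcint_add_indicator (f := 0) lowerSemicontinuous_const U r
  rwa [zero_add, ν.lcint_zero, zero_add] at h

/-- Multiplication by `c = ∞` is discontinuous at `0`, so composition with a continuous map is not
available; the induction principle treats all `c` alike. -/
theorem lowerSemicontinuous_const_mul (c : ℝ≥0∞) {g : X → ℝ≥0∞}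
    (hg : LowerSemicontinuous g) : LowerSemicontinuous fun x => c * g x := by
  refine lowerSemicontinuous_induction (Q := fun g => LowerSemicontinuous fun x => c * g x)
    ?_ ?_ ?_ hg
  · simpa using lowerSemicontinuous_const
  · intro g hg ih U r _
    have e : (fun x => c * (g + (U : Set X).indicator fun _ => r) x)
        = (fun x => c * g x) + (U : Set X).indicator fun _ => c * r := by
      funext x
      by_cases hx : x ∈ (U : Set X) <;> simp [hx, mul_add]
    rw [e]
    exact ih.add (lowerSemicontinuous_indicator U _)
  · intro g _ _ ih
    simpa [ENNReal.mul_iSup] using lowerSemicontinuous_iSup ih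

theorem Valuation.lcint_const_mul (ν : Valuation X) (c : ℝ≥0∞) {g : X → ℝ≥0∞}
    (hg : LowerSemicontinuous g) : ν.lcint (fun x => c * g x) = c * ν.lcint g := by
  refine lowerSemicontinuous_induction
    (Q := fun g => ν.lcint (fun x => c * g x) = c * ν.lcint g) ?_ ?_ ?_ hg
  · have h := ν.lcint_zero
    rw [Pi.zero_def] at h
    simp [Pi.zero_def, h]
  · intro g hg ih U r _
    have e : (fun x => c * (g + (U : Set X).indicator fun _ => r) x)
        = (fun x => c * g x) + (U : Set X).indicator fun _ => c * r := by
      funext x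
      by_cases hx : x ∈ (U : Set X) <;> simp [hx, mul_add]
    rw [e, ν.lcint_add_indicator (lowerSemicontinuous_const_mul c hg),
      ν.lcint_add_indicator hg, ih, mul_add, mul_assoc]
  · intro g hm hg ih
    have e : (fun x => c * (⨆ n, g n) x) = ⨆ n, fun x => c * g n x := by
      funext x
      simp [ENNReal.mul_iSup]
    rw [e, ν.lcint_iSup _ (fun n => lowerSemicontinuous_const_mul c (hg n))
      (Monotone.directed_le fun m n h x => mul_le_mul_right (hm h x) c),
      ν.lcint_iSup g hg hm.directed_le, ENNReal.mul_iSup]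
    exact iSup_congr ih

theorem Valuation.lcint_sum_indicator (ν : Valuation X) {n : ℕ} (r : Fin n → ℝ≥0∞)
    (U : Fin n → Opens X) :
    ν.lcint (∑ i, (U i : Set X).indicator fun _ => r i) = ∑ i, r i * ν.toFun (U i) := by
  suffices h : ∀ s : Finset (Fin n),
      LowerSemicontinuous (∑ i ∈ s, (U i : Set X).indicator fun _ => r i) ∧
      ν.lcint (∑ i ∈ s, (U i : Set X).indicator fun _ => r i) = ∑ i ∈ s, r i * ν.toFun (U i) from
    (h Finset.univ).2
  intro s
  induction s using Finset.cons_induction with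
  | empty =>
    simp only [Finset.sum_empty]
    exact ⟨lowerSemicontinuous_const, ν.lcint_zero⟩
  | cons a s ha ih =>
    rw [Finset.sum_cons, Finset.sum_cons]
    refine ⟨(lowerSemicontinuous_indicator _ _).add ih.1, ?_⟩
    rw [ν.lcint_add (lowerSemicontinuous_indicator _ _) ih.1, ih.2, ν.lcint_indicator]

/-- A simple function below `g` has its defining sum as layer cake integral; conversely, the partial
dyadic sums of `g` come from simple functions below `g`. -/
theorem Valuation.integral_eq_lcint (ν : Valuation X) {g : X → ℝ≥0∞}
    (hg : LowerSemicontinuous g) : ν.integral g = ν.lcint g := by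
  refine le_antisymm ?_ ?_
  · refine iSup_le fun n => iSup_le fun r => iSup_le fun U => iSup_le fun h => ?_
    rw [← ν.lcint_sum_indicator]
    exact ν.lcint_mono fun x => by simpa using h x
  · rw [ν.lcint_eq_iSup_dyadicSum hg]
    refine iSup_le fun n => ?_
    rw [dyadicSum, ENNReal.tsum_eq_iSup_nat]
    refine iSup_le fun N => ?_
    rw [Finset.sum_range]
    -- Unification reads off the coefficients `2⁻ⁿ` and the sets `{g > (k+1)/2ⁿ}`.
    refine le_iSup_of_le N (le_iSup_of_le (fun _ => _) (le_iSup_of_le (fun k => _)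
      (le_iSup_of_le ?_ le_rfl)))
    intro x
    have h1 : dyadicApprox g n N ≤ g := by
      conv_rhs => rw [← iSup_dyadicApprox hg]
      exact le_iSup_of_le n (le_iSup_of_le N le_rfl)
    refine le_trans (le_of_eq ?_) (h1 x)
    rw [dyadicApprox, Finset.sum_apply, Finset.sum_range]

/-! ### Change of variables and dependence of the integral on the valuation -/

theorem Valuation.lcint_map (f : C(X, Y)) (ν : Valuation X) {g : Y → ℝ≥0∞}
    (hg : LowerSemicontinuous g) : (ν.map f).lcint g = ν.lcint (g ∘ f) := by
  refine lintegral_congr fun t => ?_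
  change ν.toFun _ = ν.toFun _
  congr 1
  ext x
  exact (mem_superlevel hg).trans (mem_superlevel (hg.comp f.continuous)).symm

theorem lowerSemicontinuous_toFun (U : Opens X) :
    LowerSemicontinuous fun ν : Valuation X => ν.toFun U := by
  refine lowerSemicontinuous_iff_isOpen_preimage.2 fun a => ?_
  rcases eq_or_ne a ∞ with rfl | ha
  · simp
  · lift a to ℝ≥0 using ha
    exact isOpen_generateFrom_of_mem ⟨U, a, rfl⟩

theorem lowerSemicontinuous_lcint {g : X → ℝ≥0∞} (hg : LowerSemicontinuous g) :
    LowerSemicontinuous fun ν : Valuation X => ν.lcint g := by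
  refine lowerSemicontinuous_induction
    (Q := fun g => LowerSemicontinuous fun ν : Valuation X => ν.lcint g) ?_ ?_ ?_ hg
  · simpa [Valuation.lcint_zero] using lowerSemicontinuous_const
  · intro g hg ih U r _
    simp only [Valuation.lcint_add_indicator _ hg]
    exact ih.add (lowerSemicontinuous_const_mul r (lowerSemicontinuous_toFun U))
  · intro g hm hg ih
    simp only [Valuation.lcint_iSup _ g hg hm.directed_le]
    exact lowerSemicontinuous_iSup ih

theorem continuous_iff_lowerSemicontinuous_toFun {f : X → Valuation Y} :
    Continuous f ↔ ∀ U : Opens Y, LowerSemicontinuous fun x => (f x).toFun U := by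
  refine ⟨fun hf U => (lowerSemicontinuous_toFun U).comp hf, fun h => ?_⟩
  refine continuous_generateFrom_iff.2 ?_
  rintro _ ⟨U, r, rfl⟩
  exact (h U).isOpen_preimage r

/-! ## The monad of continuous valuations on functions -/

theorem continuous_dirac : Continuous (Valuation.dirac (X := X)) :=
  continuous_iff_lowerSemicontinuous_toFun.2 fun U => lowerSemicontinuous_indicator U 1

/-- The multiplication of the monad of continuous valuations. -/
def Valuation.join (ξ : Valuation (Valuation X)) : Valuation X where
  toFun U := ξ.lcint fun ν => ν.toFun U
  strict := by
    simp only [Valuation.strict]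
    exact ξ.lcint_zero
  mono U V h := ξ.lcint_mono fun ν => ν.mono U V h
  modular U V := by
    rw [← ξ.lcint_add (lowerSemicontinuous_toFun _) (lowerSemicontinuous_toFun _),
      ← ξ.lcint_add (lowerSemicontinuous_toFun _) (lowerSemicontinuous_toFun _)]
    exact congrArg ξ.lcint (funext fun ν => ν.modular U V)
  scott D hne hD := by
    have : Nonempty D := hne.to_subtype
    have e : (fun ν : Valuation X => ν.toFun (sSup D))
        = ⨆ U : D, fun ν : Valuation X => ν.toFun (U : Opens X) := by
      funext ν
      rw [ν.scott D hne hD, iSup_apply, iSup_subtype]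
    rw [e, ξ.lcint_iSup _ (fun U => lowerSemicontinuous_toFun _), iSup_subtype]
    exact hD.directed_val.mono_comp (g := fun U (ν : Valuation X) => ν.toFun U) _
      fun U V h ν => ν.mono U V h

theorem Valuation.lcint_join (ξ : Valuation (Valuation X)) {g : X → ℝ≥0∞}
    (hg : LowerSemicontinuous g) : ξ.join.lcint g = ξ.lcint fun ν => ν.lcint g := by
  refine lowerSemicontinuous_induction
    (Q := fun g => ξ.join.lcint g = ξ.lcint fun ν => ν.lcint g) ?_ ?_ ?_ hg
  · simp only [Valuation.lcint_zero]
    exact ξ.lcint_zero.symm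
  · intro g hg ih U r _
    simp only [Valuation.lcint_add_indicator _ hg, ih]
    rw [show (fun ν : Valuation X => ν.lcint g + r * ν.toFun U)
      = (fun ν => ν.lcint g) + fun ν => r * ν.toFun U from rfl,
      ξ.lcint_add (lowerSemicontinuous_lcint hg)
        (lowerSemicontinuous_const_mul r (lowerSemicontinuous_toFun U)),
      ξ.lcint_const_mul r (lowerSemicontinuous_toFun U)]
    rfl
  · intro g hm hg ih
    have e : (fun ν : Valuation X => ν.lcint (⨆ n, g n)) = ⨆ n, fun ν => ν.lcint (g n) := by
      funext ν
      rw [ν.lcint_iSup g hg hm.directed_le, iSup_apply]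
    rw [e, ξ.join.lcint_iSup g hg hm.directed_le,
      ξ.lcint_iSup _ (fun n => lowerSemicontinuous_lcint (hg n))
        (Monotone.directed_le fun m n h ν => ν.lcint_mono (hm h))]
    exact iSup_congr ih

theorem continuous_join : Continuous (Valuation.join (X := X)) :=
  continuous_iff_lowerSemicontinuous_toFun.2 fun U =>
    lowerSemicontinuous_lcint (lowerSemicontinuous_toFun U)

theorem Valuation.join_dirac (ν : Valuation X) : (Valuation.dirac ν).join = ν := by
  ext U
  exact Valuation.lcint_dirac ν (lowerSemicontinuous_toFun U)

theorem Valuation.join_map_toFun (f : C(X, Valuation Y)) (ν : Valuation X) (U : Opens Y) :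
    (ν.map f).join.toFun U = ν.lcint fun x => (f x).toFun U :=
  ν.lcint_map f (lowerSemicontinuous_toFun U)

theorem Valuation.join_map_dirac (ν : Valuation X) :
    (ν.map ⟨Valuation.dirac, continuous_dirac⟩).join = ν := by
  ext U
  rw [Valuation.join_map_toFun]
  exact (ν.lcint_indicator U 1).trans (one_mul _)

theorem Valuation.join_map_join (Ξ : Valuation (Valuation (Valuation X))) :
    (Ξ.map ⟨Valuation.join, continuous_join⟩).join = Ξ.join.join := by
  ext U
  rw [Valuation.join_map_toFun]
  exact (Ξ.lcint_join (lowerSemicontinuous_toFun U)).symm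

theorem Valuation.map_join (f : C(X, Y)) (ξ : Valuation (Valuation X)) :
    ξ.join.map f = (ξ.map ⟨Valuation.map f, Valuation.continuous_map f⟩).join := by
  ext U
  rw [Valuation.join_map_toFun]
  rfl

/-! ## The strength -/

/-- The continuous map `y ↦ (x, y)`. -/
def pairLeft (x : X) : C(Y, X × Y) := ⟨fun y => (x, y), by fun_prop⟩

/-- The continuous map `x ↦ (x, y)`. -/
def pairRight (y : Y) : C(X, X × Y) := ⟨fun x => (x, y), by fun_prop⟩

/-- The slice `W_x` is the directed union of the open `V` with `U × V ⊆ W` for some neighbourhood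
`U` of `x`. By Scott continuity one such `V` already has `ν(V) > r`, and then `U × {ρ | ρ(V) > r}`
is a neighbourhood of `(x, ν)` on which the bound persists. -/
theorem lowerSemicontinuous_strength (W : Opens (X × Y)) :
    LowerSemicontinuous fun a : X × Valuation Y =>
      a.2.toFun (Opens.comap (pairLeft a.1) W) := by
  rintro ⟨x, ν⟩ r hr
  let D : Set (Opens Y) := {V | ∃ U : Opens X, x ∈ U ∧ (U : Set X) ×ˢ (V : Set Y) ⊆ W}
  have hD : Opens.comap (pairLeft x) W = sSup D := by
    ext y
    simp only [SetLike.mem_coe, Opens.mem_sSup]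
    constructor
    · intro hy
      obtain ⟨U, V, hU, hV, hx, hy, h⟩ := isOpen_prod_iff.1 W.isOpen x y hy
      exact ⟨⟨V, hV⟩, ⟨⟨U, hU⟩, hx, h⟩, hy⟩
    · rintro ⟨V, ⟨U, hx, h⟩, hy⟩
      exact h ⟨hx, hy⟩
  have hdir : DirectedOn (· ≤ ·) D := by
    rintro V ⟨U, hx, h⟩ V' ⟨U', hx', h'⟩
    refine ⟨V ⊔ V', ⟨U ⊓ U', ⟨hx, hx'⟩, ?_⟩, le_sup_left, le_sup_right⟩
    rintro ⟨a, b⟩ ⟨⟨ha, ha'⟩, hb | hb⟩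
    · exact h ⟨ha, hb⟩
    · exact h' ⟨ha', hb⟩
  change r < ν.toFun (Opens.comap (pairLeft x) W) at hr
  rw [hD, ν.scott D ⟨⊥, ⊤, trivial, by simp⟩ hdir] at hr
  simp only [lt_iSup_iff] at hr
  obtain ⟨V, ⟨U, hx, h⟩, hr⟩ := hr
  filter_upwards [prod_mem_nhds (U.isOpen.mem_nhds hx)
    (lowerSemicontinuous_toFun V ν r hr)] with a ⟨ha, hν⟩
  exact (show r < a.2.toFun V from hν).trans_le (a.2.mono _ _ fun y hy => h ⟨ha, hy⟩)

/-- The strength `X × VY → V (X × Y)`. -/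
def Valuation.strength : C(X × Valuation Y, Valuation (X × Y)) where
  toFun a := a.2.map (pairLeft a.1)
  continuous_toFun :=
    continuous_iff_lowerSemicontinuous_toFun.2 fun W => lowerSemicontinuous_strength W

/-- The costrength `VX × Y → V (X × Y)`. -/
def Valuation.costrength : C(Valuation X × Y, Valuation (X × Y)) where
  toFun a := a.1.map (pairRight a.2)
  continuous_toFun := (Valuation.continuous_map ⟨Prod.swap, continuous_swap⟩).comp
    ((Valuation.strength (X := Y) (Y := X)).continuous.comp continuous_swap)

/-- The product of continuous valuations. -/
def Valuation.prod : C(Valuation X × Valuation Y, Valuation (X × Y)) where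
  toFun a := ((Valuation.strength a).map Valuation.costrength).join
  continuous_toFun := continuous_join.comp ((Valuation.continuous_map _).comp
    Valuation.strength.continuous)

theorem Valuation.prod_toFun (ν : Valuation X) (ρ : Valuation Y) (W : Opens (X × Y)) :
    (Valuation.prod (ν, ρ)).toFun W
      = ρ.lcint fun y => ν.toFun (Opens.comap (pairRight y) W) := by
  change Valuation.toFun (Valuation.join _) W = _
  rw [Valuation.join_map_toFun]
  exact ρ.lcint_map _ ((lowerSemicontinuous_toFun W).comp Valuation.costrength.continuous)

theorem Valuation.lcint_prod (ν : Valuation X) (ρ : Valuation Y) {g : X × Y → ℝ≥0∞}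
    (hg : LowerSemicontinuous g) : (Valuation.prod (ν, ρ)).lcint g
      = ρ.lcint fun y => ν.lcint fun x => g (x, y) := by
  change Valuation.lcint (Valuation.join _) g = _
  have hg' := lowerSemicontinuous_lcint hg
  rw [Valuation.lcint_join _ hg, Valuation.lcint_map _ _ hg']
  refine (ρ.lcint_map _ (hg'.comp Valuation.costrength.continuous)).trans ?_
  refine congrArg ρ.lcint (funext fun y => ?_)
  exact ν.lcint_map _ hg

/-- The product of open sets. -/
def rectOpens (U : Opens X) (V : Opens Y) : Opens (X × Y) :=
  ⟨(U : Set X) ×ˢ (V : Set Y), U.isOpen.prod V.isOpen⟩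

theorem comap_pairRight_rectOpens (U : Opens X) (V : Opens Y) (ν : Valuation X) (y : Y) :
    ν.toFun (Opens.comap (pairRight y) (rectOpens U V))
      = (V : Set Y).indicator (fun _ => ν.toFun U) y := by
  by_cases hy : y ∈ (V : Set Y)
  · rw [indicator_of_mem hy]
    congr 1
    ext x
    exact ⟨fun h => h.1, fun h => ⟨h, hy⟩⟩
  · rw [indicator_of_notMem hy, ← ν.strict]
    congr 1
    ext x
    exact ⟨fun h => hy h.2, fun h => h.elim⟩

theorem comap_pairLeft_rectOpens (U : Opens X) (V : Opens Y) (ρ : Valuation Y) (x : X) :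
    ρ.toFun (Opens.comap (pairLeft x) (rectOpens U V))
      = (U : Set X).indicator (fun _ => ρ.toFun V) x := by
  by_cases hx : x ∈ (U : Set X)
  · rw [indicator_of_mem hx]
    congr 1
    ext y
    exact ⟨fun h => h.2, fun h => ⟨hx, h⟩⟩
  · rw [indicator_of_notMem hx, ← ρ.strict]
    congr 1
    ext y
    exact ⟨fun h => hx h.1, fun h => h.elim⟩

theorem Valuation.prod_rectOpens (ν : Valuation X) (ρ : Valuation Y) (U : Opens X)
    (V : Opens Y) :
    (Valuation.prod (ν, ρ)).toFun (rectOpens U V) = ν.toFun U * ρ.toFun V := by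
  rw [Valuation.prod_toFun]
  simp only [comap_pairRight_rectOpens]
  exact ρ.lcint_indicator V _

/-! ## Uniqueness of valuations with given values on a basis -/

/-- Inclusion–exclusion by induction: `f a ⊓ s.sup f` is the supremum over `s` of the sets `f a ⊓ f
i`, again in `B`, hence the generalization over `f`. -/
theorem Valuation.toFun_sup_eq {ν ρ : Valuation X} {B : Set (Opens X)}
    (hB : ∀ U ∈ B, ∀ V ∈ B, U ⊓ V ∈ B) (h : ∀ U ∈ B, ν.toFun U = ρ.toFun U) {ι : Type*}
    (s : Finset ι) (f : ι → Opens X) (hf : ∀ i, f i ∈ B) :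
    ν.toFun (s.sup f) = ρ.toFun (s.sup f) := by
  induction s using Finset.cons_induction generalizing f with
  | empty => rw [Finset.sup_empty, ν.strict, ρ.strict]
  | cons a s ha ih =>
    rw [Finset.sup_cons]
    have h1 := ν.modular (f a) (s.sup f)
    have h2 := ρ.modular (f a) (s.sup f)
    have h3 : ν.toFun (f a ⊓ s.sup f) = ρ.toFun (f a ⊓ s.sup f) := by
      rw [Finset.sup_inf_distrib_left]
      exact ih _ fun i => hB _ (hf a) _ (hf i)
    rw [h _ (hf a), ih f hf, ← h2, h3] at h1
    -- If the intersection has infinite value, subtraction fails, but by monotonicity both unions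
    -- then have infinite value.
    rcases eq_or_ne (ρ.toFun (f a ⊓ s.sup f)) ∞ with hT | hT
    · have hle : f a ⊓ s.sup f ≤ f a ⊔ s.sup f := inf_le_left.trans le_sup_left
      rw [top_le_iff.1 ((h3.trans hT).symm.le.trans (ν.mono _ _ hle)),
        top_le_iff.1 (hT.symm.le.trans (ρ.mono _ _ hle))]
    · exact (ENNReal.add_left_inj hT).1 h1

/-- Every open set is the directed supremum of finite unions from the basis, so Scott continuity
extends the finite case. -/
theorem Valuation.ext_of_isBasis {ν ρ : Valuation X} {B : Set (Opens X)}
    (hb : Opens.IsBasis B) (hB : ∀ U ∈ B, ∀ V ∈ B, U ⊓ V ∈ B)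
    (h : ∀ U ∈ B, ν.toFun U = ρ.toFun U) : ν = ρ := by
  ext W
  obtain ⟨S, hS, rfl⟩ := Opens.isBasis_iff_cover.1 hb W
  have hm : Monotone fun s : Finset S => s.sup (Subtype.val : S → Opens X) :=
    fun s t hst => Finset.sup_mono hst
  rw [sSup_eq_iSup', iSup_eq_iSup_finset]
  simp only [← Finset.sup_eq_iSup]
  rw [ν.toFun_iSup _ hm.directed_le, ρ.toFun_iSup _ hm.directed_le]
  exact iSup_congr fun s => Valuation.toFun_sup_eq hB h s _ fun i => hS i.2

theorem rectOpens_inf (U U' : Opens X) (V V' : Opens Y) :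
    rectOpens U V ⊓ rectOpens U' V' = rectOpens (U ⊓ U') (V ⊓ V') := by
  ext a
  exact and_and_and_comm

/-- Arbitrary bases of the factors are allowed so that the construction can be iterated for triple
products. -/
theorem isBasis_rectOpens {A : Set (Opens X)} {B : Set (Opens Y)} (hA : Opens.IsBasis A)
    (hB : Opens.IsBasis B) : Opens.IsBasis (image2 rectOpens A B) := by
  refine Opens.isBasis_iff_nbhd.2 ?_
  rintro W ⟨x, y⟩ hW
  obtain ⟨U, V, hU, hV, hx, hy, h⟩ := isOpen_prod_iff.1 W.isOpen x y hW
  obtain ⟨U', hU', hx', hle⟩ := Opens.isBasis_iff_nbhd.1 hA (U := ⟨U, hU⟩) hx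
  obtain ⟨V', hV', hy', hle'⟩ := Opens.isBasis_iff_nbhd.1 hB (U := ⟨V, hV⟩) hy
  exact ⟨_, ⟨U', hU', V', hV', rfl⟩, ⟨hx', hy'⟩, fun a ha => h ⟨hle ha.1, hle' ha.2⟩⟩

theorem isBasis_univ : Opens.IsBasis (univ : Set (Opens X)) :=
  Opens.isBasis_iff_nbhd.2 fun {U _} hx => ⟨U, trivial, hx, le_rfl⟩

theorem inf_mem_image2_rectOpens {A : Set (Opens X)} {B : Set (Opens Y)}
    (hA : ∀ U ∈ A, ∀ V ∈ A, U ⊓ V ∈ A) (hB : ∀ U ∈ B, ∀ V ∈ B, U ⊓ V ∈ B) :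
    ∀ U ∈ image2 rectOpens A B, ∀ V ∈ image2 rectOpens A B, U ⊓ V ∈ image2 rectOpens A B := by
  rintro _ ⟨U, hU, V, hV, rfl⟩ _ ⟨U', hU', V', hV', rfl⟩
  exact ⟨_, hA _ hU _ hU', _, hB _ hV _ hV', (rectOpens_inf _ _ _ _).symm⟩

theorem Valuation.ext_prod {ν ρ : Valuation (X × Y)}
    (h : ∀ U V, ν.toFun (rectOpens U V) = ρ.toFun (rectOpens U V)) : ν = ρ := by
  refine Valuation.ext_of_isBasis (isBasis_rectOpens isBasis_univ isBasis_univ)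
    (inf_mem_image2_rectOpens (fun _ _ _ _ => trivial) fun _ _ _ _ => trivial) ?_
  rintro _ ⟨U, -, V, -, rfl⟩
  exact h U V

theorem Valuation.ext_prod₃ {Z : Type*} [TopologicalSpace Z] {ν ρ : Valuation (X × Y × Z)}
    (h : ∀ U V W, ν.toFun (rectOpens U (rectOpens V W))
      = ρ.toFun (rectOpens U (rectOpens V W))) : ν = ρ := by
  refine Valuation.ext_of_isBasis
    (isBasis_rectOpens isBasis_univ (isBasis_rectOpens isBasis_univ isBasis_univ))
    (inf_mem_image2_rectOpens (fun _ _ _ _ => trivial)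
      (inf_mem_image2_rectOpens (fun _ _ _ _ => trivial) fun _ _ _ _ => trivial)) ?_
  rintro _ ⟨U, -, _, ⟨V, -, W, -, rfl⟩, rfl⟩
  exact h U V W

/-- Fubini's theorem for continuous valuations. -/
theorem Valuation.prod_eq_join_map_strength (ν : Valuation X) (ρ : Valuation Y) :
    Valuation.prod (ν, ρ) = ((Valuation.costrength (ν, ρ)).map Valuation.strength).join := by
  -- On a rectangle both iterated integrals are integrals of a constant multiple of an indicator,
  -- with value `ν(U) ρ(V)`.
  refine Valuation.ext_prod fun U V => ?_
  rw [Valuation.prod_rectOpens, Valuation.join_map_toFun]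
  refine Eq.trans ?_ (ν.lcint_map _ ((lowerSemicontinuous_toFun _).comp
    Valuation.strength.continuous)).symm
  change _ = ν.lcint fun x => ρ.toFun (Opens.comap (pairLeft x) (rectOpens U V))
  simp only [comap_pairLeft_rectOpens]
  rw [ν.lcint_indicator, mul_comm]

/-- On a rectangle the left side is the iterated integral of `ν(U) ρ(V)`, and the constants factor
out one variable at a time. -/
theorem Valuation.join_map_prod (ξ : Valuation (Valuation X)) (ζ : Valuation (Valuation Y)) :
    ((Valuation.prod (ξ, ζ)).map Valuation.prod).join = Valuation.prod (ξ.join, ζ.join) := by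
  refine Valuation.ext_prod fun U V => ?_
  have hl : LowerSemicontinuous fun a : Valuation X × Valuation Y =>
      (Valuation.prod a).toFun (rectOpens U V) :=
    (lowerSemicontinuous_toFun _).comp Valuation.prod.continuous
  rw [Valuation.join_map_toFun, Valuation.prod_rectOpens, Valuation.lcint_prod _ _ hl]
  simp only [Valuation.prod_rectOpens]
  have h : ∀ ρ : Valuation Y, ξ.lcint (fun ν => ν.toFun U * ρ.toFun V)
      = ξ.join.toFun U * ρ.toFun V := fun ρ => by
    simp only [mul_comm _ (ρ.toFun V)]
    exact ξ.lcint_const_mul _ (lowerSemicontinuous_toFun U)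
  simp only [h]
  exact ζ.lcint_const_mul _ (lowerSemicontinuous_toFun V)

/-! ## Integrals and mixtures of τ-smooth measures -/

theorem measurable_of_lowerSemicontinuous {g : X → ℝ≥0∞} (hg : LowerSemicontinuous g) :
    @Measurable X ℝ≥0∞ (borel X) _ g := by
  let _ : MeasurableSpace X := borel X
  have _ : BorelSpace X := ⟨rfl⟩
  exact hg.measurable

/-- The integral of a lower semicontinuous function with respect to a Borel measure which restricts
to a continuous valuation is determined by this valuation. -/
theorem lintegral_eq_lcint {m : Measure[borel X] X} {ν : Valuation X}
    (h : ∀ U : Opens X, ν.toFun U = m (U : Set X)) {g : X → ℝ≥0∞}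
    (hg : LowerSemicontinuous g) : @lintegral X (borel X) m g = ν.lcint g := by
  let _ : MeasurableSpace X := borel X
  have _ : BorelSpace X := ⟨rfl⟩
  refine lowerSemicontinuous_induction (Q := fun g => ∫⁻ x, g x ∂m = ν.lcint g) ?_ ?_ ?_ hg
  · simp [ν.lcint_zero]
  · intro g hg ih U r _
    rw [ν.lcint_add_indicator hg, ← ih, h, ← lintegral_indicator_const U.isOpen.measurableSet,
      ← lintegral_add_left hg.measurable]
    rfl
  · intro g hm hg ih
    rw [ν.lcint_iSup g hg hm.directed_le]
    simp only [← ih, iSup_apply]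
    exact lintegral_iSup (fun n => (hg n).measurable) hm

/-- The continuous valuation given by a τ-smooth measure. -/
def valuationOfMeasure (m : Measure[borel X] X) (hm : IsTauSmooth m) : Valuation X where
  toFun U := m (U : Set X)
  strict := by simp
  mono U V h := measure_mono h
  modular U V := by
    let _ : MeasurableSpace X := borel X
    have _ : BorelSpace X := ⟨rfl⟩
    simpa using measure_union_add_inter (μ := m) (U : Set X) V.isOpen.measurableSet
  scott := hm

/-- Open sets form a π-system generating the Borel sets, and evaluations there are lower
semicontinuous; finiteness permits passing to complements. -/
theorem measurable_measure {Z : Type*} [TopologicalSpace Z] {f : Z → Measure[borel X] X}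
    (hfin : ∀ z, @IsFiniteMeasure X (borel X) (f z))
    (hf : ∀ U : Opens X, LowerSemicontinuous fun z => f z (U : Set X)) :
    @Measurable Z (Measure[borel X] X) (borel Z) (@Measure.instMeasurableSpace X (borel X)) f := by
  let _ : MeasurableSpace X := borel X
  let _ : MeasurableSpace Z := borel Z
  refine Measurable.measure_of_isPiSystem (S := {s | IsOpen s}) rfl isPiSystem_isOpen
    (fun s hs => measurable_of_lowerSemicontinuous (hf ⟨s, hs⟩))
    (measurable_of_lowerSemicontinuous (hf ⊤))

/-- The mixture `∫ f z dm(z)` of Borel measures. -/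
def mixture {Z : Type*} [TopologicalSpace Z] (m : Measure[borel Z] Z)
    (f : Z → Measure[borel X] X) : Measure[borel X] X :=
  @Measure.bind Z X (borel Z) (borel X) m f

theorem mixture_apply {Z : Type*} [TopologicalSpace Z] (m : Measure[borel Z] Z)
    {f : Z → Measure[borel X] X} (hfin : ∀ z, @IsFiniteMeasure X (borel X) (f z))
    (hf : ∀ U : Opens X, LowerSemicontinuous fun z => f z (U : Set X)) {A : Set X}
    (hA : MeasurableSet[borel X] A) :
    mixture m f A = @lintegral Z (borel Z) m fun z => f z A := by
  let _ : MeasurableSpace X := borel X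
  let _ : MeasurableSpace Z := borel Z
  exact Measure.bind_apply hA (measurable_measure hfin hf).aemeasurable

/-- On open sets the mixture is a layer cake integral of a lower semicontinuous function, and such
integrals commute with arbitrary directed suprema. -/
theorem isTauSmooth_mixture {Z : Type*} [TopologicalSpace Z] {m : Measure[borel Z] Z}
    (hm : IsTauSmooth m) {f : Z → Measure[borel X] X}
    (hfin : ∀ z, @IsFiniteMeasure X (borel X) (f z))
    (hf : ∀ U : Opens X, LowerSemicontinuous fun z => f z (U : Set X))
    (hτ : ∀ z, IsTauSmooth (f z)) : IsTauSmooth (mixture m f) := by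
  intro D hne hD
  have : Nonempty D := hne.to_subtype
  have h : ∀ U : Opens X, mixture m f U
      = (valuationOfMeasure m hm).lcint fun z => f z (U : Set X) := fun U => by
    rw [mixture_apply m hfin hf (measurableSet_opens U)]
    exact lintegral_eq_lcint (fun _ => rfl) (hf U)
  have e : (fun z => f z ((sSup D : Opens X) : Set X))
      = ⨆ U : D, fun z => f z ((U : Opens X) : Set X) := by
    funext z
    rw [hτ z D hne hD, iSup_apply, iSup_subtype]
  simp only [h]
  rw [e, Valuation.lcint_iSup _ _ (fun U => hf _), iSup_subtype]
  exact hD.directed_val.mono_comp (g := fun U z => f z ((U : Opens X) : Set X)) _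
    fun U V h z => measure_mono h

/-! ## The monad of τ-smooth probability measures on functions -/

/-- Finite measures agreeing on the π-system of open sets coincide. This makes `ι` componentwise
mono, so that identities can be checked in `V`. -/
theorem TauProb.toValuation_injective : Function.Injective (TauProb.toValuation (X := X)) := by
  intro p q h
  refine TauProb.ext_measure ?_
  let _ : MeasurableSpace X := borel X
  have _ := p.isProb
  refine ext_of_generate_finite {s | IsOpen s} rfl isPiSystem_isOpen (fun s hs => ?_) ?_
  · exact congrArg (fun ν : Valuation X => ν.toFun ⟨s, hs⟩) h
  · exact congrArg (fun ν : Valuation X => ν.toFun ⊤) h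

theorem TauProb.isEmbedding_toValuation :
    Topology.IsEmbedding (TauProb.toValuation (X := X)) :=
  ⟨⟨rfl⟩, TauProb.toValuation_injective⟩

theorem TauProb.isFinite (p : TauProb X) : @IsFiniteMeasure X (borel X) p.measure := by
  let _ : MeasurableSpace X := borel X
  have _ := p.isProb
  infer_instance

theorem lowerSemicontinuous_measure_opens (U : Opens X) :
    LowerSemicontinuous fun p : TauProb X => p.measure (U : Set X) :=
  (lowerSemicontinuous_toFun U).comp (TauProb.continuous_toValuation X)

/-- For Borel sets that need not be open, lower semicontinuity is lost and only measurability
remains; it is what the computation on Borel rectangles requires. -/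
theorem TauProb.measurable_measure_apply {A : Set X} (hA : MeasurableSet[borel X] A) :
    @Measurable (TauProb X) ℝ≥0∞ (borel (TauProb X)) _ fun p => p.measure A :=
  @Measurable.comp _ _ _ (borel (TauProb X)) (@Measure.instMeasurableSpace X (borel X)) _ _ _
    (@Measure.measurable_coe X (borel X) A hA)
    (measurable_measure TauProb.isFinite lowerSemicontinuous_measure_opens)

/-- The Dirac measure at a point. -/
def TauProb.dirac (x : X) : TauProb X where
  measure := @Measure.dirac X (borel X) x
  isProb := @Measure.dirac.isProbabilityMeasure X (borel X) x
  isTauSmooth D hne hD := by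
    have h : ∀ U : Opens X, @Measure.dirac X (borel X) x (U : Set X)
        = (Valuation.dirac x).toFun U := fun U =>
      @Measure.dirac_apply' X (borel X) _ x (measurableSet_opens U)
    simp only [h]
    exact (Valuation.dirac x).scott D hne hD

theorem TauProb.toValuation_dirac (x : X) :
    (TauProb.dirac x).toValuation = Valuation.dirac x := by
  ext U
  exact @Measure.dirac_apply' X (borel X) _ x (measurableSet_opens U)

theorem TauProb.continuous_dirac : Continuous (TauProb.dirac (X := X)) := by
  refine continuous_induced_rng.2 ?_
  rw [show TauProb.toValuation ∘ TauProb.dirac = Valuation.dirac (X := X) from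
    funext TauProb.toValuation_dirac]
  exact TauSmooth.continuous_dirac

/-- The multiplication of the monad of τ-smooth probability measures. -/
def TauProb.join (μ : TauProb (TauProb X)) : TauProb X where
  measure := mixture μ.measure TauProb.measure
  isProb := @IsProbabilityMeasure.mk X (borel X) _ (by
    rw [mixture_apply _ TauProb.isFinite lowerSemicontinuous_measure_opens
      (@MeasurableSet.univ X (borel X))]
    simp only [fun p : TauProb X => p.isProb.measure_univ, lintegral_const, one_mul]
    exact μ.isProb.measure_univ)
  isTauSmooth := isTauSmooth_mixture μ.isTauSmooth TauProb.isFinite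
    lowerSemicontinuous_measure_opens TauProb.isTauSmooth

theorem TauProb.join_apply (μ : TauProb (TauProb X)) {A : Set X}
    (hA : MeasurableSet[borel X] A) : μ.join.measure A
      = @lintegral (TauProb X) (borel (TauProb X)) μ.measure fun p => p.measure A :=
  mixture_apply _ TauProb.isFinite lowerSemicontinuous_measure_opens hA

theorem TauProb.toValuation_join (μ : TauProb (TauProb X)) : μ.join.toValuation
    = (μ.toValuation.map ⟨TauProb.toValuation, TauProb.continuous_toValuation X⟩).join := by
  ext U
  rw [Valuation.join_map_toFun]
  exact (μ.join_apply (measurableSet_opens U)).trans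
    (lintegral_eq_lcint (fun _ => rfl) (lowerSemicontinuous_measure_opens U))

theorem TauProb.continuous_join : Continuous (TauProb.join (X := X)) := by
  refine continuous_induced_rng.2 ?_
  rw [show TauProb.toValuation ∘ TauProb.join (X := X) = _ from
    funext TauProb.toValuation_join]
  exact TauSmooth.continuous_join.comp ((Valuation.continuous_map _).comp
    (TauProb.continuous_toValuation _))

/-- The strength `X × PY → P (X × Y)`, `(x, p) ↦ δ_x ⊗ p`. -/
def TauProb.strength : C(X × TauProb Y, TauProb (X × Y)) where
  toFun a := a.2.map (pairLeft a.1)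
  continuous_toFun := by
    refine continuous_induced_rng.2 ?_
    have h : TauProb.toValuation ∘ (fun a : X × TauProb Y => a.2.map (pairLeft a.1))
        = Valuation.strength ∘ Prod.map id TauProb.toValuation :=
      funext fun a => TauProb.toValuation_map _ _
    rw [h]
    exact Valuation.strength.continuous.comp
      (continuous_id.prodMap (TauProb.continuous_toValuation Y))

/-! ## Product measures -/

/-- The extension is the mixture `∫ δ_x ⊗ ν dμ(x)`. Continuity of the strength with `ν` fixed gives
the semicontinuity that makes it τ-smooth, and on the product σ-algebra it is the slice formula for
`μ ⊗ ν`. -/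
theorem exists_isTauSmooth_prod (μ : Measure[borel X] X) (ν : Measure[borel Y] Y)
    (_hμ : @IsFiniteMeasure X (borel X) μ) (hν : @IsFiniteMeasure Y (borel Y) ν)
    (hμτ : IsTauSmooth μ) (hντ : IsTauSmooth ν) :
    ∃ m : Measure[borel (X × Y)] (X × Y), IsTauSmooth m ∧
      ∀ S : Set (X × Y), MeasurableSet[@Prod.instMeasurableSpace X Y (borel X) (borel Y)] S →
        m S = (@Measure.prod X Y (borel X) (borel Y) μ ν) S := by
  let f : X → Measure[borel (X × Y)] (X × Y) := fun x => pushforward (pairLeft x) ν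
  have hfin : ∀ x, @IsFiniteMeasure (X × Y) (borel (X × Y)) (f x) := fun x =>
    @Measure.isFiniteMeasure_map Y (X × Y) (borel (X × Y)) (borel Y) ν hν _
  have hfU : ∀ (x : X) (U : Opens (X × Y)), f x U
      = ((valuationOfMeasure ν hντ).map (pairLeft x)).toFun U := fun x U =>
    pushforward_apply _ _ (measurableSet_opens U)
  have hf : ∀ U : Opens (X × Y), LowerSemicontinuous fun x => f x (U : Set (X × Y)) := by
    intro U
    simp only [hfU]
    exact (lowerSemicontinuous_strength U).comp (g := fun x => (x, valuationOfMeasure ν hντ))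
      (by fun_prop)
  have hτ : ∀ x, IsTauSmooth (f x) := fun x D hne hD => by
    simp only [hfU]
    exact Valuation.scott _ D hne hD
  refine ⟨mixture μ f, isTauSmooth_mixture hμτ hfin hf hτ, fun S hS => ?_⟩
  have hSb : MeasurableSet[borel (X × Y)] S := by
    let _ : MeasurableSpace X := borel X
    have _ : BorelSpace X := ⟨rfl⟩
    let _ : MeasurableSpace Y := borel Y
    have _ : BorelSpace Y := ⟨rfl⟩
    exact prod_le_borel_prod _ hS
  rw [mixture_apply μ hfin hf hSb, @Measure.prod_apply X Y (borel X) (borel Y) μ ν _ S hS]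
  refine @lintegral_congr _ (borel X) _ _ _ fun x => ?_
  exact pushforward_apply _ _ hSb

end Functions

/-! ## Coherence of products of valuations -/

section Coherence

variable {X Y Z : Type u} [TopologicalSpace X] [TopologicalSpace Y] [TopologicalSpace Z]

theorem Valuation.toFun_congr (ν : Valuation X) {U V : Opens X} (h : ∀ x, x ∈ U ↔ x ∈ V) :
    ν.toFun U = ν.toFun V :=
  congrArg ν.toFun (Opens.ext (Set.ext h))

/-- The preimage of a rectangle is a rectangle, so both sides take the value `ν(f⁻¹U) ρ(g⁻¹V)` on `U
× V`. -/
theorem Valuation.map_prod {X' Y' : Type u} [TopologicalSpace X'] [TopologicalSpace Y']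
    (f : C(X, X')) (g : C(Y, Y')) (ν : Valuation X) (ρ : Valuation Y) :
    (Valuation.prod (ν, ρ)).map (f.prodMap g) = Valuation.prod (ν.map f, ρ.map g) := by
  refine Valuation.ext_prod fun U V => ?_
  rw [Valuation.prod_rectOpens]
  exact Valuation.prod_rectOpens ν ρ (Opens.comap f U) (Opens.comap g V)

theorem Valuation.prod_assoc (ν : Valuation X) (ρ : Valuation Y) (σ : Valuation Z) :
    (Valuation.prod (Valuation.prod (ν, ρ), σ)).map ⟨Equiv.prodAssoc X Y Z, by
      change Continuous fun a : (X × Y) × Z => (a.1.1, a.1.2, a.2)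
      fun_prop⟩ = Valuation.prod (ν, Valuation.prod (ρ, σ)) := by
  refine Valuation.ext_prod₃ fun U V W => ?_
  refine (Valuation.toFun_congr (Valuation.prod (Valuation.prod (ν, ρ), σ))
    (V := rectOpens (rectOpens U V) W) fun a => and_assoc.symm).trans ?_
  simp only [Valuation.prod_rectOpens, mul_assoc]

theorem Valuation.dirac_top (x : X) : (Valuation.dirac x).toFun ⊤ = 1 := by
  simp [Valuation.dirac]

/-- The preimage of `U` under the projection is the rectangle `⊤ × U`, and a point valuation has
total mass `1`. -/
theorem Valuation.map_snd_prod_dirac (x : X) (ν : Valuation Y) :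
    (Valuation.prod (Valuation.dirac x, ν)).map ⟨Prod.snd, continuous_snd⟩ = ν := by
  refine Valuation.ext (funext fun U => ?_)
  refine (Valuation.toFun_congr (Valuation.prod (Valuation.dirac x, ν))
    (V := rectOpens ⊤ U) fun a => ⟨fun h => ⟨trivial, h⟩, fun h => h.2⟩).trans ?_
  rw [Valuation.prod_rectOpens, Valuation.dirac_top, one_mul]

theorem Valuation.map_fst_prod_dirac (ν : Valuation X) (y : Y) :
    (Valuation.prod (ν, Valuation.dirac y)).map ⟨Prod.fst, continuous_fst⟩ = ν := by
  refine Valuation.ext (funext fun U => ?_)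
  refine (Valuation.toFun_congr (Valuation.prod (ν, Valuation.dirac y))
    (V := rectOpens U ⊤) fun a => ⟨fun h => ⟨h, trivial⟩, fun h => h.1⟩).trans ?_
  rw [Valuation.prod_rectOpens, Valuation.dirac_top, mul_one]

theorem Valuation.map_swap_prod (ν : Valuation X) (ρ : Valuation Y) :
    (Valuation.prod (ν, ρ)).map ⟨Prod.swap, continuous_swap⟩ = Valuation.prod (ρ, ν) := by
  refine Valuation.ext_prod fun U V => ?_
  refine (Valuation.toFun_congr (Valuation.prod (ν, ρ)) (V := rectOpens V U)
    fun a => and_comm).trans ?_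
  simp only [Valuation.prod_rectOpens, mul_comm]

theorem Valuation.prod_dirac (x : X) (y : Y) :
    Valuation.prod (Valuation.dirac x, Valuation.dirac y) = Valuation.dirac (x, y) := by
  refine Valuation.ext_prod fun U V => ?_
  rw [Valuation.prod_rectOpens]
  by_cases hx : x ∈ (U : Set X) <;> by_cases hy : y ∈ (V : Set Y) <;>
    simp [Valuation.dirac, rectOpens, hx, hy]

end Coherence

/-! ## The strong monad `V` -/

/-- The monad structure on `V`. -/
def monadStructureV : MonadStructure V.{u} where
  unit :=
    { app := fun X => TopCat.ofHom ⟨Valuation.dirac, continuous_dirac⟩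
      naturality := fun _ _ _ => rfl }
  mul :=
    { app := fun X => TopCat.ofHom ⟨Valuation.join, continuous_join⟩
      naturality := fun X Y f => by
        ext ξ : 1
        exact (Valuation.map_join f.hom ξ).symm }
  assoc X := by
    ext Ξ : 1
    exact Valuation.join_map_join Ξ
  left_unit X := by
    ext ν : 1
    exact Valuation.join_dirac ν
  right_unit X := by
    ext ν : 1
    exact Valuation.join_map_dirac ν

/-- The strength of the monad `V`. -/
def strengthV : Strength monadStructureV.{u}.monad where
  s X Y := TopCat.ofHom Valuation.strength
  -- As the strength is a pushforward, these laws only compare preimages and hold definitionally;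
  -- `mul` alone involves an integral.
  natural_left _ _ := rfl
  natural_right _ _ _ _ := rfl
  unitor _ := rfl
  associator _ _ _ := rfl
  unit _ _ := rfl
  mul X Y := by
    ext a : 1
    refine Valuation.ext (funext fun W => ?_)
    refine (Valuation.join_map_toFun _ _ W).trans ?_
    exact Valuation.lcint_map _ _ ((lowerSemicontinuous_toFun W).comp
      Valuation.strength.continuous)

theorem isCommutative_strengthV : strengthV.{u}.IsCommutative := fun X Y => by
  ext a : 1
  exact Valuation.prod_eq_join_map_strength a.1 a.2

/-- The symmetric monoidal structure on the functor `V`. -/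
@[reducible] def laxBraidedV : V.{u}.LaxBraided where
  ε := monadStructureV.unit.app (𝟙_ TopCat)
  μ X Y := strengthV.nabla X Y
  μ_natural_left {X Y} f X' := by
    ext a : 1
    exact (Valuation.map_prod f.hom (ContinuousMap.id X') a.1 a.2).symm
  μ_natural_right {X Y} X' f := by
    ext a : 1
    exact (Valuation.map_prod (ContinuousMap.id X') f.hom a.1 a.2).symm
  associativity X Y Z := by
    ext a : 1
    exact Valuation.prod_assoc a.1.1 a.1.2 a.2
  left_unitality X := by
    ext a : 1
    exact (Valuation.map_snd_prod_dirac (X := PUnit) a.1 a.2).symm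
  right_unitality X := by
    ext a : 1
    exact (Valuation.map_fst_prod_dirac (Y := PUnit) a.1 a.2).symm
  braided X Y := by
    ext a : 1
    exact Valuation.map_swap_prod a.1 a.2

/-- The symmetric monoidal monad `V`. -/
def symmetricMonoidalMonadV : SymmetricMonoidalMonad monadStructureV.{u}.monad where
  lax := laxBraidedV
  ε_eq := rfl
  unit X Y := by
    ext a : 1
    exact Valuation.prod_dirac a.1 a.2
  mul X Y := by
    ext a : 1
    exact Valuation.join_map_prod a.1 a.2

/-! ## Restriction of monads and strengths along monomorphisms -/

section Restriction

variable {C : Type u} [Category.{v} C] {S T : C ⥤ C}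

/-- A monad structure on `T` restricts along a monomorphism `i : S ⟶ T` if unit and multiplication
do. -/
def MonadStructure.restrict (M : MonadStructure T) (i : S ⟶ T) [∀ X, Mono (i.app X)]
    (η : 𝟭 C ⟶ S) (m : S ⋙ S ⟶ S) (hη : ∀ X, η.app X ≫ i.app X = M.unit.app X)
    (hm : ∀ X, m.app X ≫ i.app X = S.map (i.app X) ≫ i.app (T.obj X) ≫ M.mul.app X) :
    MonadStructure S where
  unit := η
  mul := m
  assoc X := by
    have h := m.naturality (i.app X)
    simp only [Functor.comp_obj, Functor.comp_map] at h
    -- After composing with the mono `i.app X`, `hm` exchanges the multiplication of `S` for that of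
    -- `T`, and naturality moves the copies of `i` to the front, leaving `M.assoc`.
    rw [← cancel_mono (i.app X), Category.assoc, Category.assoc, hm, ← S.map_comp_assoc, hm,
      ← reassoc_of% h, reassoc_of% (hm (T.obj X)), ← M.assoc]
    simp only [Functor.map_comp, Category.assoc, NatTrans.naturality_assoc, Functor.comp_obj]
    rw [← T.map_comp_assoc, ← i.naturality, T.map_comp_assoc]
  left_unit X := by
    have h := η.naturality (i.app X)
    simp only [Functor.id_obj, Functor.id_map] at h
    rw [← cancel_mono (i.app X), Category.assoc, hm, ← reassoc_of% h,
      reassoc_of% (hη (T.obj X)), M.left_unit, Category.comp_id]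
    exact (Category.id_comp _).symm
  right_unit X := by
    rw [← cancel_mono (i.app X), Category.assoc, hm, ← S.map_comp_assoc, hη,
      NatTrans.naturality_assoc, M.right_unit]
    exact (Category.comp_id _).trans (Category.id_comp _).symm

variable [MonoidalCategory C] {N : MonadStructure S} {M : MonadStructure T} (i : S ⟶ T)

/-- A strength restricts along a monomorphism of monads if its components do. -/
def Strength.restrict [∀ X, Mono (i.app X)] (σ : Strength M.monad)
    (hη : ∀ X, N.unit.app X ≫ i.app X = M.unit.app X)
    (hm : ∀ X, N.mul.app X ≫ i.app X = S.map (i.app X) ≫ i.app (T.obj X) ≫ M.mul.app X)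
    (s : ∀ X Y : C, X ⊗ S.obj Y ⟶ S.obj (X ⊗ Y))
    (hs : ∀ X Y, s X Y ≫ i.app (X ⊗ Y) = X ◁ i.app Y ≫ σ.s X Y) : Strength N.monad :=
  -- Established ahead of the structure because `mul` uses it at `g = i.app Y`.
  have nat_right : ∀ (X : C) {Y W : C} (g : Y ⟶ W),
      X ◁ S.map g ≫ s X W = s X Y ≫ S.map (X ◁ g) := fun X Y W g => by
    rw [← cancel_mono (i.app _), Category.assoc, Category.assoc, hs, i.naturality,
      reassoc_of% (hs X Y), ← MonoidalCategory.whiskerLeft_comp_assoc, i.naturality,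
      MonoidalCategory.whiskerLeft_comp_assoc]
    exact congrArg (X ◁ i.app Y ≫ ·) (σ.natural_right X g)
  { s := s
    natural_left := fun {X Z} f Y => by
      change f ▷ S.obj Y ≫ s Z Y = s X Y ≫ S.map (f ▷ Y)
      rw [← cancel_mono (i.app _), Category.assoc, Category.assoc, hs, i.naturality,
        reassoc_of% (hs X Y), ← whisker_exchange_assoc]
      exact congrArg (X ◁ i.app Y ≫ ·) (σ.natural_left f Y)
    natural_right := nat_right
    unitor := fun X => by
      change s _ _ ≫ S.map _ = (λ_ (S.obj X)).hom
      rw [← cancel_mono (i.app _), Category.assoc, i.naturality, reassoc_of% (hs (𝟙_ C) X),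
        ← leftUnitor_naturality]
      exact congrArg (𝟙_ C ◁ i.app X ≫ ·) (σ.unitor X)
    associator := fun X Y Z => by
      change s _ _ ≫ S.map _ = (α_ X Y (S.obj Z)).hom ≫ X ◁ s Y Z ≫ s X (Y ⊗ Z)
      rw [← cancel_mono (i.app _), Category.assoc, Category.assoc, Category.assoc, i.naturality,
        reassoc_of% (hs (X ⊗ Y) Z), hs, ← MonoidalCategory.whiskerLeft_comp_assoc, hs]
      refine (congrArg ((X ⊗ Y) ◁ i.app Z ≫ ·) (σ.associator X Y Z)).trans ?_
      simp
    unit := fun X Y => by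
      change X ◁ N.unit.app Y ≫ s X Y = N.unit.app _
      rw [← cancel_mono (i.app _), Category.assoc, hs, ← MonoidalCategory.whiskerLeft_comp_assoc,
        hη]
      exact (σ.unit X Y).trans (hη (X ⊗ Y)).symm
    mul := fun X Y => by
      change s X (S.obj Y) ≫ S.map (s X Y) ≫ N.mul.app _ = X ◁ N.mul.app Y ≫ s X Y
      rw [← cancel_mono (i.app _)]
      simp only [Category.assoc]
      rw [hm, hs, ← S.map_comp_assoc, hs, S.map_comp_assoc, ← reassoc_of% (nat_right X (i.app Y)),
        NatTrans.naturality_assoc, reassoc_of% (hs X (T.obj Y)),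
        ← MonoidalCategory.whiskerLeft_comp_assoc X (N.mul.app Y), hm]
      simp only [MonoidalCategory.whiskerLeft_comp, Category.assoc]
      exact congrArg (fun k => X ◁ S.map (i.app Y) ≫ X ◁ i.app (T.obj Y) ≫ k) (σ.mul X Y) }

variable [BraidedCategory C] {σ : Strength M.monad} {s : Strength N.monad}

theorem Strength.t_comp (hs : ∀ X Y, s.s X Y ≫ i.app (X ⊗ Y) = X ◁ i.app Y ≫ σ.s X Y) (X Y : C) :
    s.t X Y ≫ i.app (X ⊗ Y) = i.app X ▷ Y ≫ σ.t X Y := by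
  change ((β_ (S.obj X) Y).hom ≫ s.s Y X ≫ S.map (β_ Y X).hom) ≫ _
    = _ ≫ (β_ (T.obj X) Y).hom ≫ σ.s Y X ≫ T.map (β_ Y X).hom
  rw [Category.assoc, Category.assoc, i.naturality, reassoc_of% (hs Y X),
    BraidedCategory.braiding_naturality_left_assoc]

theorem Strength.t_natural_right (X : C) {Y Z : C} (f : Y ⟶ Z) :
    T.obj X ◁ f ≫ σ.t X Z = σ.t X Y ≫ T.map (X ◁ f) := by
  change _ ≫ (β_ (T.obj X) Z).hom ≫ σ.s Z X ≫ T.map (β_ Z X).hom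
    = ((β_ (T.obj X) Y).hom ≫ σ.s Y X ≫ T.map (β_ Y X).hom) ≫ _
  have h : f ▷ T.obj X ≫ σ.s Z X = σ.s Y X ≫ T.map (f ▷ X) := σ.natural_left f X
  rw [BraidedCategory.braiding_naturality_right_assoc, reassoc_of% h, ← T.map_comp,
    BraidedCategory.braiding_naturality_left, Category.assoc, Category.assoc, T.map_comp]

/-- Naturality of `s` in its parameter, taken at `i.app X`, lets `i` pass through the strength; `hm`
and `t_comp` do the rest. -/
theorem Strength.nabla_comp
    (hm : ∀ X, N.mul.app X ≫ i.app X = S.map (i.app X) ≫ i.app (T.obj X) ≫ M.mul.app X)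
    (hs : ∀ X Y, s.s X Y ≫ i.app (X ⊗ Y) = X ◁ i.app Y ≫ σ.s X Y) (X Y : C) :
    s.nabla X Y ≫ i.app (X ⊗ Y) = (i.app X ⊗ₘ i.app Y) ≫ σ.nabla X Y := by
  change (s.s (S.obj X) Y ≫ S.map (s.t X Y) ≫ N.mul.app (X ⊗ Y)) ≫ _
    = _ ≫ σ.s (T.obj X) Y ≫ T.map (σ.t X Y) ≫ M.mul.app (X ⊗ Y)
  have h : i.app X ▷ S.obj Y ≫ s.s (T.obj X) Y = s.s (S.obj X) Y ≫ S.map (i.app X ▷ Y) :=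
    s.natural_left (i.app X) Y
  rw [Category.assoc, Category.assoc, hm, ← S.map_comp_assoc, s.t_comp (σ := σ) i hs, S.map_comp_assoc,
    ← reassoc_of% h, NatTrans.naturality_assoc, reassoc_of% (hs (T.obj X) Y),
    MonoidalCategory.tensorHom_def, Category.assoc]

theorem Strength.IsCommutative.restrict [∀ X, Mono (i.app X)] (hσ : σ.IsCommutative)
    (hm : ∀ X, N.mul.app X ≫ i.app X = S.map (i.app X) ≫ i.app (T.obj X) ≫ M.mul.app X)
    (hs : ∀ X Y, s.s X Y ≫ i.app (X ⊗ Y) = X ◁ i.app Y ≫ σ.s X Y) : s.IsCommutative := by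
  intro X Y
  rw [← cancel_mono (i.app (X ⊗ Y)), s.nabla_comp (σ := σ) i hm hs, hσ]
  change _ ≫ σ.t X (T.obj Y) ≫ T.map (σ.s X Y) ≫ M.mul.app (X ⊗ Y)
    = (s.t X (S.obj Y) ≫ S.map (s.s X Y) ≫ N.mul.app (X ⊗ Y)) ≫ _
  rw [Category.assoc, Category.assoc, hm, ← S.map_comp_assoc, hs, NatTrans.naturality_assoc,
    reassoc_of% (s.t_comp (σ := σ) i hs X (S.obj Y)), T.map_comp_assoc,
    ← reassoc_of% (σ.t_natural_right X (i.app Y)), MonoidalCategory.tensorHom_def,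
    Category.assoc]

/-- A symmetric lax monoidal structure restricts along a monomorphism if its structure maps do. -/
@[reducible] def laxBraidedRestrict [∀ X, Mono (i.app X)] (L : T.LaxBraided)
    (ε : 𝟙_ C ⟶ S.obj (𝟙_ C))
    (μ : ∀ X Y, S.obj X ⊗ S.obj Y ⟶ S.obj (X ⊗ Y)) (hε : ε ≫ i.app (𝟙_ C) = L.ε)
    (hμ : ∀ X Y, μ X Y ≫ i.app (X ⊗ Y) = (i.app X ⊗ₘ i.app Y) ≫ L.μ X Y) :
    S.LaxBraided where
  ε := ε
  μ := μ
  μ_natural_left {X Y} f X' := by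
    have h : S.map f ▷ S.obj X' ≫ (i.app Y ⊗ₘ i.app X')
        = (i.app X ⊗ₘ i.app X') ≫ T.map f ▷ T.obj X' := by
      rw [← tensorHom_id, ← tensorHom_id, tensorHom_comp_tensorHom, tensorHom_comp_tensorHom,
        i.naturality, Category.id_comp, Category.comp_id]
    rw [← cancel_mono (i.app _), Category.assoc, Category.assoc, hμ, i.naturality,
      reassoc_of% (hμ X X'), ← L.μ_natural_left, reassoc_of% h]
  μ_natural_right {X Y} X' f := by
    have h : S.obj X' ◁ S.map f ≫ (i.app X' ⊗ₘ i.app Y)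
        = (i.app X' ⊗ₘ i.app X) ≫ T.obj X' ◁ T.map f := by
      rw [← id_tensorHom, ← id_tensorHom, tensorHom_comp_tensorHom, tensorHom_comp_tensorHom,
        i.naturality, Category.id_comp, Category.comp_id]
    rw [← cancel_mono (i.app _), Category.assoc, Category.assoc, hμ, i.naturality,
      reassoc_of% (hμ X' X), ← L.μ_natural_right, reassoc_of% h]
  associativity X Y Z := by
    rw [← cancel_mono (i.app _)]
    simp only [Category.assoc]
    rw [hμ, i.naturality, reassoc_of% (hμ (X ⊗ Y) Z)]
    have h1 : μ X Y ▷ S.obj Z ≫ (i.app (X ⊗ Y) ⊗ₘ i.app Z)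
        = ((i.app X ⊗ₘ i.app Y) ⊗ₘ i.app Z) ≫ L.μ X Y ▷ T.obj Z := by
      rw [← tensorHom_id, ← tensorHom_id, tensorHom_comp_tensorHom, tensorHom_comp_tensorHom, hμ,
        Category.id_comp, Category.comp_id]
    have h2 : S.obj X ◁ μ Y Z ≫ (i.app X ⊗ₘ i.app (Y ⊗ Z))
        = (i.app X ⊗ₘ i.app Y ⊗ₘ i.app Z) ≫ T.obj X ◁ L.μ Y Z := by
      rw [← id_tensorHom, ← id_tensorHom, tensorHom_comp_tensorHom, tensorHom_comp_tensorHom, hμ,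
        Category.id_comp, Category.comp_id]
    rw [reassoc_of% h1, reassoc_of% h2, L.associativity, associator_naturality_assoc]
  left_unitality X := by
    have h : ε ▷ S.obj X ≫ (i.app (𝟙_ C) ⊗ₘ i.app X) = 𝟙_ C ◁ i.app X ≫ L.ε ▷ T.obj X := by
      rw [← tensorHom_id, ← tensorHom_id, ← id_tensorHom, tensorHom_comp_tensorHom,
        tensorHom_comp_tensorHom, hε, Category.id_comp, Category.id_comp, Category.comp_id]
    rw [← cancel_mono (i.app _)]
    simp only [Category.assoc]
    rw [i.naturality, reassoc_of% (hμ (𝟙_ C) X), ← leftUnitor_naturality, L.left_unitality,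
      reassoc_of% h]
  right_unitality X := by
    have h : S.obj X ◁ ε ≫ (i.app X ⊗ₘ i.app (𝟙_ C)) = i.app X ▷ 𝟙_ C ≫ T.obj X ◁ L.ε := by
      rw [← id_tensorHom, ← id_tensorHom, ← tensorHom_id, tensorHom_comp_tensorHom,
        tensorHom_comp_tensorHom, hε, Category.id_comp, Category.id_comp, Category.comp_id]
    rw [← cancel_mono (i.app _)]
    simp only [Category.assoc]
    rw [i.naturality, reassoc_of% (hμ X (𝟙_ C)), ← rightUnitor_naturality, L.right_unitality,
      reassoc_of% h]
  braided X Y := by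
    rw [← cancel_mono (i.app _), Category.assoc, Category.assoc, hμ, i.naturality,
      reassoc_of% (hμ X Y)]
    refine (congrArg ((i.app X ⊗ₘ i.app Y) ≫ ·) (L.braided X Y)).trans ?_
    simp

/-- A symmetric monoidal monad structure restricts along a monomorphism of monads if its structure
maps do. -/
def SymmetricMonoidalMonad.restrict [∀ X, Mono (i.app X)]
    (L : SymmetricMonoidalMonad M.monad)
    (hη : ∀ X, N.unit.app X ≫ i.app X = M.unit.app X)
    (hm : ∀ X, N.mul.app X ≫ i.app X = S.map (i.app X) ≫ i.app (T.obj X) ≫ M.mul.app X)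
    (μ : ∀ X Y, S.obj X ⊗ S.obj Y ⟶ S.obj (X ⊗ Y))
    (hμ : ∀ X Y, μ X Y ≫ i.app (X ⊗ Y) = (i.app X ⊗ₘ i.app Y) ≫ L.lax.μ X Y) :
    SymmetricMonoidalMonad N.monad where
  lax := laxBraidedRestrict i L.lax (N.unit.app (𝟙_ C)) μ ((hη _).trans L.ε_eq.symm) hμ
  ε_eq := rfl
  unit X Y := by
    change (N.unit.app X ⊗ₘ N.unit.app Y) ≫ μ X Y = N.unit.app (X ⊗ Y)
    rw [← cancel_mono (i.app _), Category.assoc, hμ, hη, tensorHom_comp_tensorHom_assoc, hη, hη]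
    exact L.unit X Y
  mul X Y := by
    change μ (S.obj X) (S.obj Y) ≫ S.map (μ X Y) ≫ N.mul.app (X ⊗ Y)
      = (N.mul.app X ⊗ₘ N.mul.app Y) ≫ μ X Y
    -- Naturality of `μ` in both variables at once is read off from the restricted lax structure.
    have h : μ (S.obj X) (S.obj Y) ≫ S.map (i.app X ⊗ₘ i.app Y)
        = (S.map (i.app X) ⊗ₘ S.map (i.app Y)) ≫ μ (T.obj X) (T.obj Y) :=
      letI := laxBraidedRestrict i L.lax (N.unit.app (𝟙_ C)) μ ((hη _).trans L.ε_eq.symm) hμ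
      (Functor.LaxMonoidal.μ_natural S (i.app X) (i.app Y)).symm
    rw [← cancel_mono (i.app _)]
    simp only [Category.assoc]
    rw [hm, hμ, ← S.map_comp_assoc, hμ, S.map_comp_assoc, reassoc_of% h,
      NatTrans.naturality_assoc, reassoc_of% (hμ (T.obj X) (T.obj Y)),
      tensorHom_comp_tensorHom_assoc (N.mul.app X), hm, hm]
    simp only [← tensorHom_comp_tensorHom, Category.assoc]
    exact congrArg (fun k => (S.map (i.app X) ⊗ₘ S.map (i.app Y)) ≫
      (i.app (T.obj X) ⊗ₘ i.app (T.obj Y)) ≫ k) (L.mul X Y)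

end Restriction

/-! ## The strong monad `P` -/

instance mono_ι (X : TopCat.{u}) : Mono (ι.app X) :=
  (TopCat.mono_iff_injective _).2 TauProb.toValuation_injective

/-- The unit of the monad `P`. -/
def unitP : 𝟭 TopCat.{u} ⟶ P.{u} where
  app X := TopCat.ofHom ⟨TauProb.dirac, TauProb.continuous_dirac⟩
  naturality X Y f := by
    ext x : 1
    refine TauProb.toValuation_injective (Eq.trans (TauProb.toValuation_dirac _) ?_)
    refine Eq.trans ?_ (TauProb.toValuation_map _ _).symm
    exact (congrArg (Valuation.map f.hom) (TauProb.toValuation_dirac x)).symm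

theorem unitP_comp_ι (X : TopCat.{u}) :
    unitP.app X ≫ ι.app X = monadStructureV.unit.app X := by
  ext x : 1
  exact TauProb.toValuation_dirac x

/-- The components of the multiplication of the monad `P`. -/
def joinP (X : TopCat.{u}) : P.obj (P.obj X) ⟶ P.obj X :=
  TopCat.ofHom ⟨TauProb.join, TauProb.continuous_join⟩

theorem joinP_comp_ι (X : TopCat.{u}) : joinP X ≫ ι.app X
    = P.map (ι.app X) ≫ ι.app (V.obj X) ≫ monadStructureV.mul.app X := by
  ext μ : 1
  refine (TauProb.toValuation_join μ).trans (congrArg Valuation.join ?_)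
  exact (TauProb.toValuation_map (X := TauProb X) (ι.app X).hom μ).symm

/-- The multiplication of the monad `P`. -/
def mulP : P.{u} ⋙ P.{u} ⟶ P.{u} where
  app := joinP
  naturality X Y f := by
    rw [← cancel_mono (ι.app Y), Category.assoc, Category.assoc, joinP_comp_ι, ι.naturality,
      reassoc_of% (joinP_comp_ι X), Functor.comp_map, ← P.map_comp_assoc, ι.naturality,
      P.map_comp_assoc, ι.naturality_assoc]
    exact congrArg (fun k => P.map (ι.app X) ≫ ι.app (V.obj X) ≫ k)
      (monadStructureV.mul.naturality f)

/-- The monad structure on `P`. -/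
def monadStructureP : MonadStructure P.{u} :=
  monadStructureV.restrict ι unitP mulP unitP_comp_ι joinP_comp_ι

/-- The strength of the monad `P`. -/
def strengthP : Strength monadStructureP.{u}.monad :=
  Strength.restrict ι strengthV unitP_comp_ι joinP_comp_ι
    (fun _ _ => TopCat.ofHom TauProb.strength) fun _ _ => by
      ext a : 1
      exact TauProb.toValuation_map _ _

theorem strengthP_comp_ι (X Y : TopCat.{u}) :
    strengthP.s X Y ≫ ι.app (X ⊗ Y) = X ◁ ι.app Y ≫ strengthV.s X Y := by
  ext a : 1
  exact TauProb.toValuation_map _ _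

theorem nabla_strengthP_comp_ι (X Y : TopCat.{u}) : strengthP.nabla X Y ≫ ι.app (X ⊗ Y)
    = (ι.app X ⊗ₘ ι.app Y) ≫ strengthV.nabla X Y :=
  Strength.nabla_comp (σ := strengthV) (s := strengthP) ι joinP_comp_ι strengthP_comp_ι X Y

/-- The symmetric monoidal monad `P`. -/
def symmetricMonoidalMonadP : SymmetricMonoidalMonad monadStructureP.{u}.monad :=
  symmetricMonoidalMonadV.restrict ι unitP_comp_ι joinP_comp_ι (fun X Y => strengthP.nabla X Y)
    nabla_strengthP_comp_ι

/-! ### Products of probability measures on Borel rectangles -/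

theorem measurableSet_rect {X Y : TopCat.{u}} {A : Set X} {B : Set Y}
    (hA : MeasurableSet[borel X] A) (hB : MeasurableSet[borel Y] B) :
    MeasurableSet[borel (X ⊗ Y : TopCat.{u})] (rect A B) :=
  MeasurableSet.inter (m := borel (X × Y))
    (measurable_borel (X := X × Y) ⟨Prod.fst, continuous_fst⟩ hA)
    (measurable_borel (X := X × Y) ⟨Prod.snd, continuous_snd⟩ hB)

theorem lintegral_pushforward {X : Type u} {Y : Type v} [TopologicalSpace X] [TopologicalSpace Y]
    (f : C(X, Y)) (m : @MeasureTheory.Measure X (borel X)) {g : Y → ℝ≥0∞}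
    (hg : @Measurable Y ℝ≥0∞ (borel Y) _ g) :
    @MeasureTheory.lintegral Y (borel Y) (pushforward f m) g
      = @MeasureTheory.lintegral X (borel X) m fun x => g (f x) :=
  @MeasureTheory.lintegral_map X Y (borel X) (borel Y) m g f hg (measurable_borel f)

/-- As `A` and `B` need not be open, the formula for valuations does not suffice. Unfolding `∇`
gives `∫ t(p, y)(A × B) dq(y)`, whose integrand is `p(A) 1_B(y)`. -/
theorem nabla_strengthP_rect {X Y : TopCat.{u}} (p : P.obj X) (q : P.obj Y) {A : Set X}
    {B : Set Y} (hA : MeasurableSet[borel X] A) (hB : MeasurableSet[borel Y] B) :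
    TauProb.measure (strengthP.nabla X Y (pair p q)) (rect A B)
      = p.measure A * q.measure B := by
  have hR := measurableSet_rect hA hB
  have hm := TauProb.measurable_measure_apply hR
  have ht : ∀ y : Y, TauProb.measure (strengthP.t X Y (pair p y)) (rect A B)
      = B.indicator (fun _ => p.measure A) y := by
    intro y
    have h1 : TauProb.measure (strengthP.t X Y (pair p y)) (rect A B)
        = p.measure {x | pair x y ∈ rect A B} :=
      (pushforward_apply _ _ hR).trans
        (pushforward_apply _ _ (measurable_borel (β_ Y X).hom.hom hR))
    rw [h1]
    by_cases hy : y ∈ B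
    · rw [Set.indicator_of_mem hy]
      congr 1
      ext x
      exact ⟨fun h => h.1, fun h => ⟨h, hy⟩⟩
    · rw [Set.indicator_of_notMem hy, ← MeasureTheory.measure_empty (μ := p.measure)]
      congr 1
      ext x
      exact ⟨fun h => hy h.2, fun h => h.elim⟩
  refine (TauProb.join_apply _ hR).trans ?_
  refine (lintegral_pushforward (strengthP.t X Y).hom _ hm).trans ?_
  refine (lintegral_pushforward _ _ (hm.comp (measurable_borel (strengthP.t X Y).hom))).trans ?_
  refine (@MeasureTheory.lintegral_congr Y (borel Y) q.measure _ _ ht).trans ?_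
  exact @MeasureTheory.lintegral_indicator_const Y (borel Y) q.measure B hB _

end TauSmooth

end
-- Assembly of the theorem
theorem mainTheorem7 :
    -- the monads `V` and `P` with their strengths
    (∃ (MV : TauSmooth.MonadStructure TauSmooth.V.{u})
      (MP : TauSmooth.MonadStructure TauSmooth.P.{u})
      (sV : TauSmooth.Strength MV.monad) (sP : TauSmooth.Strength MP.monad),
      -- unit, multiplication and strength of `V`
      (∀ (X : TopCat.{u}) (x : X) (g : X → ℝ≥0∞), LowerSemicontinuous g →
        TauSmooth.Valuation.integral (MV.unit.app X x) g = g x) ∧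
      (∀ (X : TopCat.{u}) (ξ : TauSmooth.V.obj (TauSmooth.V.obj X)) (g : X → ℝ≥0∞),
        LowerSemicontinuous g →
        TauSmooth.Valuation.integral (MV.mul.app X ξ) g =
          TauSmooth.Valuation.integral ξ (fun ν : TauSmooth.V.obj X => ν.integral g)) ∧
      (∀ (X Y : TopCat.{u}) (x : X) (ν : TauSmooth.V.obj Y) (W : Opens (X ⊗ Y : TopCat.{u})),
        TauSmooth.Valuation.toFun (sV.s X Y (TauSmooth.pair x ν)) W =
          ν.toFun (TauSmooth.openSlice W x)) ∧
      -- unit, multiplication and strength of `P`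
      (∀ (X : TopCat.{u}) (x : X) (A : Set X), MeasurableSet[borel X] A →
        (TauSmooth.TauProb.measure (MP.unit.app X x)) A = A.indicator 1 x) ∧
      (∀ (X : TopCat.{u}) (μ : TauSmooth.P.obj (TauSmooth.P.obj X)) (A : Set X),
        MeasurableSet[borel X] A →
        (TauSmooth.TauProb.measure (MP.mul.app X μ)) A =
          @MeasureTheory.lintegral (TauSmooth.P.obj X) (borel (TauSmooth.P.obj X)) μ.measure
            (fun p : TauSmooth.P.obj X => p.measure A)) ∧
      (∀ (X Y : TopCat.{u}) (x : X) (p : TauSmooth.P.obj Y) (A : Set (X ⊗ Y : TopCat.{u})),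
        MeasurableSet[borel (X ⊗ Y : TopCat.{u})] A →
        (TauSmooth.TauProb.measure (sP.s X Y (TauSmooth.pair x p))) A =
          p.measure (TauSmooth.slice A x)) ∧
      -- `P` is a submonad of `V`
      (∀ X : TopCat.{u}, Topology.IsEmbedding (TauSmooth.ι.app X)) ∧
      (∃ j : MonadHom MP.monad MV.monad, j.toNatTrans = TauSmooth.ι) ∧
      -- the strength of `P` is the restriction of the strength of `V`
      (∀ X Y : TopCat.{u},
        sP.s X Y ≫ TauSmooth.ι.app (X ⊗ Y) = X ◁ TauSmooth.ι.app Y ≫ sV.s X Y) ∧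
      -- both strengths are commutative
      sV.IsCommutative ∧ sP.IsCommutative ∧
      -- `V` and `P` are symmetric monoidal monads and `ι` is a morphism of such
      (∃ (LV : TauSmooth.SymmetricMonoidalMonad MV.monad)
        (LP : TauSmooth.SymmetricMonoidalMonad MP.monad),
        (∀ X Y : TopCat.{u}, LV.lax.μ X Y = sV.nabla X Y) ∧
        (∀ X Y : TopCat.{u}, LP.lax.μ X Y = sP.nabla X Y) ∧
        @NatTrans.IsMonoidal _ _ _ _ _ _ TauSmooth.P.{u} TauSmooth.V.{u} TauSmooth.ι
          LP.lax.toLaxMonoidal LV.lax.toLaxMonoidal) ∧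
      -- the monoidal structure of `P` forms product measures
      (∀ (X Y : TopCat.{u}) (p : TauSmooth.P.obj X) (q : TauSmooth.P.obj Y)
        (A : Set X) (B : Set Y), MeasurableSet[borel X] A → MeasurableSet[borel Y] B →
        (TauSmooth.TauProb.measure (sP.nabla X Y (TauSmooth.pair p q))) (TauSmooth.rect A B) =
          p.measure A * q.measure B)) ∧
    -- products of τ-smooth measures extend to τ-smooth Borel measures
    (∀ (X : Type u) (Y : Type v) [TopologicalSpace X] [TopologicalSpace Y]
      (μ : Measure[borel X] X) (ν : Measure[borel Y] Y),
      @MeasureTheory.IsFiniteMeasure X (borel X) μ →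
      @MeasureTheory.IsFiniteMeasure Y (borel Y) ν →
      TauSmooth.IsTauSmooth μ → TauSmooth.IsTauSmooth ν →
      ∃ m : Measure[borel (X × Y)] (X × Y), TauSmooth.IsTauSmooth m ∧
        ∀ S : Set (X × Y), MeasurableSet[@Prod.instMeasurableSpace X Y (borel X) (borel Y)] S →
          m S = (@MeasureTheory.Measure.prod X Y (borel X) (borel Y) μ ν) S) := by

  refine ⟨⟨TauSmooth.monadStructureV, TauSmooth.monadStructureP, TauSmooth.strengthV,
    TauSmooth.strengthP, ?_, ?_, ?_, ?_, ?_, ?_, ?_, ?_, ?_, TauSmooth.isCommutative_strengthV,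
    ?_, ?_, ?_⟩, ?_⟩
  · intro X x g hg
    exact (TauSmooth.Valuation.integral_eq_lcint _ hg).trans
      (TauSmooth.Valuation.lcint_dirac x hg)
  · intro X ξ g hg
    have h : (fun ν : TauSmooth.V.obj X => TauSmooth.Valuation.integral ν g)
        = fun ν : TauSmooth.Valuation X => ν.lcint g :=
      funext fun ν => TauSmooth.Valuation.integral_eq_lcint _ hg
    rw [h]
    exact ((TauSmooth.Valuation.integral_eq_lcint _ hg).trans
      (TauSmooth.Valuation.lcint_join ξ hg)).trans
      (TauSmooth.Valuation.integral_eq_lcint _ (TauSmooth.lowerSemicontinuous_lcint hg)).symm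
  · intro X Y x ν W
    rfl
  · intro X x A hA
    exact @MeasureTheory.Measure.dirac_apply' X (borel X) _ x hA
  · intro X μ A hA
    exact TauSmooth.TauProb.join_apply μ hA
  · intro X Y x p A hA
    exact TauSmooth.pushforward_apply _ _ hA
  · intro X
    exact TauSmooth.TauProb.isEmbedding_toValuation
  · refine ⟨{ toNatTrans := TauSmooth.ι, app_η := TauSmooth.unitP_comp_ι, app_μ := fun X => ?_ },
      rfl⟩
    exact (TauSmooth.joinP_comp_ι X).trans (Category.assoc _ _ _).symm
  · exact TauSmooth.strengthP_comp_ι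
  · exact TauSmooth.isCommutative_strengthV.restrict TauSmooth.ι TauSmooth.joinP_comp_ι
      TauSmooth.strengthP_comp_ι
  · refine ⟨TauSmooth.symmetricMonoidalMonadV, TauSmooth.symmetricMonoidalMonadP,
      fun _ _ => rfl, fun _ _ => rfl, ?_⟩
    exact @NatTrans.IsMonoidal.mk _ _ _ _ _ _ _ _ _
      TauSmooth.symmetricMonoidalMonadP.lax.toLaxMonoidal
      TauSmooth.symmetricMonoidalMonadV.lax.toLaxMonoidal (TauSmooth.unitP_comp_ι _)
      TauSmooth.nabla_strengthP_comp_ι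
  · intro X Y p q A B hA hB
    exact TauSmooth.nabla_strengthP_rect p q hA hB
  · intro X Y _ _ μ ν hμ hν hμτ hντ
    exact TauSmooth.exists_isTauSmooth_prod μ ν hμ hν hμτ hντ
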